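/- \textbf{Theorem (improved confidence region for the price-based MNL MLE).} Let $N\ge 1$, $d\ge 0$, $T\ge 1$ and $0\le t\le T$ be integers, and let $\lambda\ge 0$, $W>0$, $P\in\mathbb R$ and $\delta\in(0,1)$ with $2\delta\le N$. For $x\in\mathbb R^d$ and $p\in\mathbb R$ put $\widetilde x(p):=(x,-p\,x)\in\mathbb R^{2d}$. Let $\widetilde{\mathcal D}=\{(i_m,X_m,p_m,S_m)\}_{m=1}^t$ be a random data set on a probability space, where $X_m=(x_{m1},\dots,x_{mN})$ are item features in $\mathbb R^d$ with $\|x_{mj}\|_2\le 1$, $p_m=(p_{m1},\dots,p_{mN})\in\mathbb R^N$ are prices, $S_m\subseteq\{1,\dots,N\}$ is the offered assortment and $i_m\in\{0,1,\dots,N\}$ is the choice ($0$ is no purchase). Write $\widetilde x_{mj}:=\widetilde x_{mj}(p_{mj})$ and, for $\vartheta\in\mathbb R^{2d}$, $$q_{mj}(\vartheta)=\frac{e^{\widetilde x_{mj}^\top\vartheta}}{1+\sum_{k\in S_m}e^{\widetilde x_{mk}^\top\vartheta}}\ (j\in S_m),\qquad q_{m0}(\vartheta)=\frac{1}{1+\sum_{k\in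 S_m}e^{\widetilde x_{mk}^\top\vartheta}} .$$ Let $\mathcal G$ be the $\sigma$-algebra generated by the designs $\{(\widetilde x_{m1},\dots,\widetilde x_{mN}),S_m\}_{m=1}^t$. Assume that for some $\vartheta^\star\in\mathbb R^{2d}$ with $\|\vartheta^\star\|_2\le W$, conditionally on $\mathcal G$, the choices $i_1,\dots,i_t$ are mutually independent and $i_m=j$ has probability $q_{mj}(\vartheta^\star)$ for $j\in S_m\cup\{0\}$ (and probability $0$ for other $j$). Define $$\ell^\lambda(\vartheta)=-\sum_{m=1}^t\sum_{j\in S_m\cup\{0\}}\mathbf 1\{i_m=j\}\log q_{mj}(\vartheta)+\frac\lambda2\|\vartheta\|_2^2,\qquad H^\lambda(\vartheta)=\nabla^2\ell^\lambda(\vartheta),\qquad \|v\|_A=\sqrt{v^\top A v}.$$ The burn-in condition holds if $H^\lambda(\vartheta^\star)$ is invertible (this is automatic for $\lambda>0$) and $$\max_{m\le t,\ j\in S_m}\|\widetilde x_{mj}\|_{H^\lambda(\vartheta^\star)^{-1}}\ \le\ \frac{1}{144\sqrt{2d\log(N/\delta)}}\wedge\frac{1}{24\sqrt\lambda\,W},$$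 where a fraction with denominator $0$ is read as $+\infty$ and a maximum over the empty set imposes no condition. Then for every fixed $x\in\mathbb R^d$ with $\|x\|_2\le 1$ and every fixed $p\in[0,P]$ the following holds with probability at least $1-\delta$ conditionally on designs that satisfy the burn-in condition: there is an event whose conditional probability given $\mathcal G$ is almost surely at least $1-\delta$ wherever the burn-in condition holds, and on this event, wherever the burn-in condition holds, $\ell^\lambda$ has a unique minimizer $\widehat\vartheta^\lambda$ over $\mathbb R^{2d}$, and (i) $\tfrac13 H^\lambda(\vartheta^\star)\preceq H^\lambda(\widehat\vartheta^\lambda)\preceq 3H^\lambda(\vartheta^\star)$ in the positive semidefinite order; (ii) $\displaystyle|\widetilde x(p)^\top(\widehat\vartheta^\lambda-\vartheta^\star)|\le 16\,\|\widetilde x(p)\|_{H^\lambda(\vartheta^\star)^{-1}}\Big(\sqrt{\log(NT/\delta)}+\sqrt\lambda\,W\Big).$ -/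

import Mathlib

open MeasureTheory ProbabilityTheory

noncomputable section

/-- The parameter space `ℝ^{2d}` with the Euclidean norm, written as two blocks of size `d`. -/
abbrev Param (d : ℕ) : Type := EuclideanSpace ℝ (Fin d ⊕ Fin d)

/-- The price-augmented feature `(x, -p x)` of an item with feature `x` and price `p`. -/
def augment {d : ℕ} (x : EuclideanSpace ℝ (Fin d)) (p : ℝ) : Param d :=
  WithLp.toLp 2 (Sum.elim (fun k => x k) (fun k => -p * x k))

/-- The multinomial logit probabilities `q_i(S | v)` for `i` in the choice set `S ∪ {0}`.
The no-purchase option `0` is `none`, and item `i` is `some i`. -/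
def choiceProb {N : ℕ} (S : Finset (Fin N)) (v : Fin N → ℝ) : Option (Fin N) → ℝ
  | none => 1 / (1 + ∑ j ∈ S, v j)
  | some i => v i / (1 + ∑ j ∈ S, v j)

/-- A data set of `t` rounds: in round `m` the items have features `feature m`, the assortment
`assortment m` is offered at prices `price m`, and `choice m` is the option chosen. -/
structure PricingData (N d t : ℕ) where
  choice : Fin t → Option (Fin N)
  feature : Fin t → Fin N → EuclideanSpace ℝ (Fin d)
  price : Fin t → Fin N → ℝ
  assortment : Fin t → Finset (Fin N)

namespace PricingData

variable {N d t : ℕ}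

/-- The augmented feature of item `j` in round `m` at the price charged in that round. -/
def pricedFeature (D : PricingData N d t) (m : Fin t) (j : Fin N) : Param d :=
  augment (D.feature m j) (D.price m j)

/-- The probability of option `o` in round `m` under the parameter `θ`. -/
def prob (D : PricingData N d t) (θ : Param d) (m : Fin t) (o : Option (Fin N)) : ℝ :=
  choiceProb (D.assortment m) (fun j => Real.exp (inner ℝ (D.pricedFeature m j) θ)) o

/-- The regularized negative log-likelihood
`-∑ₘ ∑_{j ∈ Sₘ ∪ {0}} 1{iₘ = j} log q_j + (lam / 2) ‖θ‖²`. -/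
def loss (D : PricingData N d t) (lam : ℝ) (θ : Param d) : ℝ :=
  -(∑ m, ∑ o ∈ Finset.insertNone (D.assortment m),
      (if D.choice m = o then (1 : ℝ) else 0) * Real.log (D.prob θ m o))
    + lam / 2 * ‖θ‖ ^ 2

/-- The Hessian matrix of second partial derivatives of the regularized loss. -/
def hessian (D : PricingData N d t) (lam : ℝ) (θ : Param d) :
    Matrix (Fin d ⊕ Fin d) (Fin d ⊕ Fin d) ℝ :=
  Matrix.of fun k l =>
    fderiv ℝ (fun η => fderiv ℝ (D.loss lam) η (EuclideanSpace.single l 1)) θ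
      (EuclideanSpace.single k 1)

/-- `θ` is a global minimizer of the regularized loss. -/
def IsMLE (D : PricingData N d t) (lam : ℝ) (θ : Param d) : Prop :=
  ∀ η : Param d, D.loss lam θ ≤ D.loss lam η

end PricingData

/-- The weighted norm `‖x‖_A = √(xᵀ A x)`. -/
def weightedNorm {d : ℕ} (A : Matrix (Fin d ⊕ Fin d) (Fin d ⊕ Fin d) ℝ) (x : Param d) : ℝ :=
  Real.sqrt (dotProduct (fun k => x k) (A.mulVec (fun k => x k)))

/-- The Hessian at `θ` is invertible and every offered priced feature satisfies
`‖x‖_{H⁻¹} ≤ 1 / (144 √(2 d log (N / δ))) ∧ 1 / (24 √lam W)`. The bounds are multiplied out, so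
that a fraction with denominator zero reads as `+∞`. -/
def BurnIn {N d t : ℕ} (D : PricingData N d t) (lam W δ : ℝ) (θ : Param d) : Prop :=
  IsUnit (D.hessian lam θ).det ∧
  ∀ m, ∀ j ∈ D.assortment m,
    weightedNorm (D.hessian lam θ)⁻¹ (D.pricedFeature m j) *
        (144 * Real.sqrt (2 * d * Real.log (N / δ))) ≤ 1 ∧
    weightedNorm (D.hessian lam θ)⁻¹ (D.pricedFeature m j) * (24 * Real.sqrt lam * W) ≤ 1

section Random

variable {Ω : Type*} {N d t : ℕ}

/-- The sigma-algebra generated by the priced feature matrices and the assortments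
of all rounds. -/
abbrev designSigma (D : Ω → PricingData N d t) : MeasurableSpace Ω :=
  ⨆ m : Fin t,
    MeasurableSpace.comap (fun ω => (D ω).pricedFeature m) inferInstance ⊔
      MeasurableSpace.comap (fun ω => (D ω).assortment m) ⊤

/-- All components of the random data set are measurable (finite types being discrete). -/
structure MeasurableData [MeasurableSpace Ω] (D : Ω → PricingData N d t) : Prop where
  feature : ∀ m j, Measurable fun ω => (D ω).feature m j
  price : ∀ m j, Measurable fun ω => (D ω).price m j
  assortment : ∀ m (S : Finset (Fin N)), MeasurableSet {ω | (D ω).assortment m = S}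
  choice : ∀ m (o : Option (Fin N)), MeasurableSet {ω | (D ω).choice m = o}

/-- Conditionally on the priced features and assortments, the choices of the `t` rounds are
mutually independent. (Taking `A m = univ` gives the product formula for subfamilies.) -/
def CondIndepChoices [MeasurableSpace Ω] (μ : Measure Ω) (D : Ω → PricingData N d t) : Prop :=
  ∀ A : Fin t → Set (Option (Fin N)),
    μ⟦⋂ m, {ω | (D ω).choice m ∈ A m} | designSigma D⟧ =ᵐ[μ]
      fun ω => ∏ m, (μ⟦{ω | (D ω).choice m ∈ A m} | designSigma D⟧) ω

/-- Conditionally on the priced features and assortments, the choice of each round follows the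
multinomial logit model with parameter `θ` on the choice set `Sₘ ∪ {0}`. -/
def MNLChoices [MeasurableSpace Ω] (μ : Measure Ω) (D : Ω → PricingData N d t)
    (θ : Param d) : Prop :=
  ∀ (m : Fin t) (o : Option (Fin N)),
    μ⟦{ω | (D ω).choice m = o} | designSigma D⟧ =ᵐ[μ]
      fun ω => if o ∈ Finset.insertNone ((D ω).assortment m) then (D ω).prob θ m o else 0

end Random

end

/-!
# Accuracy of the maximum likelihood estimator of the price-based multinomial logit model

Every round is a softmax distribution on the options "no purchase" (feature zero) and the offered
items, so the penalized negative log-likelihood is a sum of log-partition functions minus linear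
terms plus a quadratic. Let `H` be its Hessian at the true parameter `θ⋆`, let `n = 2 d`,
`L = log (N / δ)` and `L' = log (N T / δ)`. The score at `θ⋆` is `lam θ⋆` minus a sum of independent
centred vectors, the noise.

*Concentration.* A Pinelis type inequality in the norm `‖·‖_{H⁻¹}` bounds the noise by `4 √(n L)`,
because its total variance in this norm is at most the trace of the identity
(`sum_prod_mul_cosh_norm_sum_le`). Bernstein's inequality and a union bound control the noise along
`H⁻¹ a`, for the fixed direction `a = (x, -p x)` and for all features `a` of the data, by
`5 √L' ‖a‖_{H⁻¹}`. Bernstein's inequality is in its Gaussian range only if `L'` is at most a multiple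
of `n L`; when it is not, the bound along `H⁻¹ a` already follows from the bound on the norm
(`le_prodProb_noise_bounds`). This dichotomy is what makes the burn-in condition independent of `T`.

*Localization.* If the utilities of the options move by at most `s`, the softmax weights, hence the
covariances and the Hessian, change by a factor of at most `exp (2 s)`
(`inner_info_add_le`, `le_inner_info_add`). Under the burn-in condition this makes the gradient
point outwards on the ellipsoid of radius `2 (4 √(n L) + √lam W)` around `θ⋆`, so the minimizer lies
inside it and the two Hessians are comparable. The error of the linearization
`θ̂ - θ⋆ ≈ -H⁻¹ (score)` is of order `s` times this radius. A crude bound on `s` would leave a factor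
`√n`; applying the linearization to the features themselves and absorbing the error term instead
gives a bound on `s` by the directional estimates, free of the dimension
(`exists_minimizer_of_score_bounds`).

*Conditioning.* There are finitely many choice vectors, and their conditional law given the designs
is the product of the softmax distributions. Conditional probabilities of events whose sections are
determined by the design are therefore finite sums (`condProb_choice_mem`), to which the
concentration bounds apply pointwise.
-/

open scoped RealInnerProductSpace

/-! ### Softmax distributions and their log-partition function -/

namespace MNL

section Softmax

variable {ι E : Type*} [NormedAddCommGroup E] [InnerProductSpace ℝ E]

/-- The normalizing constant `∑ₒ exp ⟪f o, θ⟫` of the softmax distribution on the options `O`. -/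
noncomputable def partitionSum (O : Finset ι) (f : ι → E) (θ : E) : ℝ :=
  ∑ o ∈ O, Real.exp ⟪f o, θ⟫

/-- The softmax weight of the option `o`. -/
noncomputable def softmax (O : Finset ι) (f : ι → E) (θ : E) (o : ι) : ℝ :=
  Real.exp ⟪f o, θ⟫ / partitionSum O f θ

/-- The mean feature under the softmax distribution. -/
noncomputable def softmaxMean (O : Finset ι) (f : ι → E) (θ : E) : E :=
  ∑ o ∈ O, softmax O f θ o • f o

/-- The covariance operator of the feature under the softmax distribution. -/
noncomputable def softmaxCov (O : Finset ι) (f : ι → E) (θ : E) : E →L[ℝ] E :=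
  ∑ o ∈ O, softmax O f θ o • InnerProductSpace.rankOne ℝ
    (f o - softmaxMean O f θ) (f o - softmaxMean O f θ)

variable {O : Finset ι} {f : ι → E}

lemma partitionSum_pos (hO : O.Nonempty) (θ : E) : 0 < partitionSum O f θ :=
  Finset.sum_pos (fun _ _ => Real.exp_pos _) hO

lemma softmax_pos (hO : O.Nonempty) (θ : E) (o : ι) : 0 < softmax O f θ o :=
  div_pos (Real.exp_pos _) (partitionSum_pos hO θ)

lemma sum_softmax (hO : O.Nonempty) (θ : E) : ∑ o ∈ O, softmax O f θ o = 1 := by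
  simp only [softmax, ← Finset.sum_div]
  exact div_self (partitionSum_pos hO θ).ne'

lemma sum_softmax_smul_sub (hO : O.Nonempty) (θ : E) :
    ∑ o ∈ O, softmax O f θ o • (f o - softmaxMean O f θ) = 0 := by
  simp only [smul_sub, Finset.sum_sub_distrib, ← Finset.sum_smul, sum_softmax hO, one_smul]
  simp [softmaxMean]

lemma inner_softmaxCov (θ u v : E) :
    ⟪softmaxCov O f θ u, v⟫ = ∑ o ∈ O, softmax O f θ o *
      (⟪f o - softmaxMean O f θ, u⟫ * ⟪f o - softmaxMean O f θ, v⟫) := by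
  simp only [softmaxCov, _root_.sum_apply, sum_inner, _root_.smul_apply,
    InnerProductSpace.rankOne_apply, real_inner_smul_left]

/-- The variance of a linear functional is its least mean square deviation from a constant. -/
lemma inner_softmaxCov_self_le (hO : O.Nonempty) (θ u : E) (c : ℝ) :
    ⟪softmaxCov O f θ u, u⟫ ≤ ∑ o ∈ O, softmax O f θ o * (⟪f o, u⟫ - c) ^ 2 := by
  have h0 : ∑ o ∈ O, softmax O f θ o * ⟪f o - softmaxMean O f θ, u⟫ = 0 := by
    have := congrArg (fun z => ⟪z, u⟫) (sum_softmax_smul_sub (f := f) hO θ)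
    simpa [sum_inner, real_inner_smul_left] using this
  have key : ∑ o ∈ O, softmax O f θ o * (⟪f o, u⟫ - c) ^ 2 =
      ⟪softmaxCov O f θ u, u⟫ + 2 * (⟪softmaxMean O f θ, u⟫ - c) *
        (∑ o ∈ O, softmax O f θ o * ⟪f o - softmaxMean O f θ, u⟫) +
        (⟪softmaxMean O f θ, u⟫ - c) ^ 2 * ∑ o ∈ O, softmax O f θ o := by
    rw [inner_softmaxCov, Finset.mul_sum, Finset.mul_sum, ← Finset.sum_add_distrib,
      ← Finset.sum_add_distrib]
    refine Finset.sum_congr rfl fun o _ => ?_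
    rw [inner_sub_left]; ring
  rw [key, h0, sum_softmax hO]
  nlinarith [sq_nonneg (⟪softmaxMean O f θ, u⟫ - c)]

lemma hasFDerivAt_log_partitionSum (hO : O.Nonempty) (θ : E) :
    HasFDerivAt (fun η => Real.log (partitionSum O f η)) (innerSL ℝ (softmaxMean O f θ)) θ := by
  have h1 : HasFDerivAt (fun η => partitionSum O f η)
      (∑ o ∈ O, Real.exp ⟪f o, θ⟫ • innerSL ℝ (f o)) θ :=
    HasFDerivAt.fun_sum fun o _ => ((innerSL ℝ (f o)).hasFDerivAt (x := θ)).exp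
  refine (h1.log (partitionSum_pos hO θ).ne').congr_fderiv ?_
  ext u
  simp only [softmaxMean, softmax, _root_.smul_apply, _root_.sum_apply,
    innerSL_apply_apply, sum_inner, real_inner_smul_left, smul_eq_mul, Finset.mul_sum]
  refine Finset.sum_congr rfl fun o _ => ?_
  ring

lemma softmax_eq_exp (hO : O.Nonempty) (θ : E) (o : ι) :
    softmax O f θ o = Real.exp (⟪f o, θ⟫ - Real.log (partitionSum O f θ)) := by
  rw [Real.exp_sub, Real.exp_log (partitionSum_pos hO θ), softmax]

lemma hasFDerivAt_softmax (hO : O.Nonempty) (θ : E) (o : ι) :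
    HasFDerivAt (fun η => softmax O f η o)
      (softmax O f θ o • innerSL ℝ (f o - softmaxMean O f θ)) θ := by
  have h := (((innerSL ℝ (f o)).hasFDerivAt (x := θ)).sub
    (hasFDerivAt_log_partitionSum (f := f) hO θ)).exp
  have e : (fun η => softmax O f η o) =
      fun η => Real.exp (⟪f o, η⟫ - Real.log (partitionSum O f η)) :=
    funext fun η => softmax_eq_exp hO η o
  rw [e]
  refine h.congr_fderiv ?_
  rw [softmax_eq_exp hO θ o, map_sub]
  rfl

lemma hasFDerivAt_softmaxMean (hO : O.Nonempty) (θ : E) :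
    HasFDerivAt (fun η => softmaxMean O f η) (softmaxCov O f θ) θ := by
  have h : HasFDerivAt (fun η => softmaxMean O f η)
      (∑ o ∈ O, (softmax O f θ o • innerSL ℝ (f o - softmaxMean O f θ)).smulRight (f o)) θ :=
    HasFDerivAt.fun_sum fun o _ => (hasFDerivAt_softmax hO θ o).smul_const (f o)
  refine h.congr_fderiv ?_
  ext u
  have h0 := sum_softmax_smul_sub (f := f) hO θ
  have h1 : ∑ o ∈ O, (softmax O f θ o * ⟪f o - softmaxMean O f θ, u⟫) • softmaxMean O f θ = 0 := by
    have := congrArg (fun z => ⟪z, u⟫) h0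
    simp only [sum_inner, real_inner_smul_left, inner_zero_left] at this
    rw [← Finset.sum_smul, this, zero_smul]
  simp only [softmaxCov, _root_.sum_apply, _root_.smul_apply,
    ContinuousLinearMap.smulRight_apply, InnerProductSpace.rankOne_apply, innerSL_apply_apply,
    smul_eq_mul, smul_smul, smul_sub, Finset.sum_sub_distrib, h1, sub_zero]

/-- If all features move by at most `s` in the direction `u`, the softmax weights change by a
factor of at most `exp (2 s)`. -/
lemma softmax_add_le (hO : O.Nonempty) (θ u : E) {s : ℝ} (hs : ∀ o ∈ O, |⟪f o, u⟫| ≤ s)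
    {o : ι} (ho : o ∈ O) :
    softmax O f (θ + u) o ≤ Real.exp (2 * s) * softmax O f θ o := by
  have hZ : Real.exp (-s) * partitionSum O f θ ≤ partitionSum O f (θ + u) := by
    rw [partitionSum, Finset.mul_sum]
    refine Finset.sum_le_sum fun a ha => ?_
    rw [← Real.exp_add, inner_add_right]
    exact Real.exp_le_exp.2 (by linarith [neg_abs_le ⟪f a, u⟫, hs a ha])
  have hZ0 := partitionSum_pos (f := f) hO θ
  rw [softmax, softmax, div_le_iff₀ (partitionSum_pos hO _), mul_div_assoc', div_mul_eq_mul_div,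
    le_div_iff₀ hZ0]
  calc Real.exp ⟪f o, θ + u⟫ * partitionSum O f θ
      ≤ Real.exp (s + ⟪f o, θ⟫) * partitionSum O f θ := by
        gcongr
        rw [inner_add_right]
        linarith [le_abs_self ⟪f o, u⟫, hs o ho]
    _ = Real.exp (2 * s) * Real.exp ⟪f o, θ⟫ * (Real.exp (-s) * partitionSum O f θ) := by
        rw [show s + ⟪f o, θ⟫ = 2 * s + ⟪f o, θ⟫ + -s by ring, Real.exp_add, Real.exp_add]
        ring
    _ ≤ _ := by gcongr

/-- Self-concordance: the softmax covariance changes by a factor of at most `exp (2 s)`. -/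
lemma softmaxCov_add_le (hO : O.Nonempty) (θ u w : E) {s : ℝ} (hs : ∀ o ∈ O, |⟪f o, u⟫| ≤ s) :
    ⟪softmaxCov O f (θ + u) w, w⟫ ≤ Real.exp (2 * s) * ⟪softmaxCov O f θ w, w⟫ := by
  refine (inner_softmaxCov_self_le hO (θ + u) w ⟪softmaxMean O f θ, w⟫).trans ?_
  rw [inner_softmaxCov, Finset.mul_sum]
  refine Finset.sum_le_sum fun o ho => ?_
  rw [inner_sub_left, ← sq, ← mul_assoc]
  exact mul_le_mul_of_nonneg_right (softmax_add_le hO θ u hs ho) (sq_nonneg _)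

lemma inner_softmaxCov_self_nonneg (hO : O.Nonempty) (θ u : E) :
    0 ≤ ⟪softmaxCov O f θ u, u⟫ := by
  rw [inner_softmaxCov]
  exact Finset.sum_nonneg fun o _ => mul_nonneg (softmax_pos hO θ o).le (mul_self_nonneg _)

end Softmax

/-! ### The penalized likelihood over several rounds -/

section Rounds

variable {τ ι E : Type*} [Fintype τ] [NormedAddCommGroup E] [InnerProductSpace ℝ E]

/-- The penalized negative log-likelihood of the choices `c m` from the option sets `O m`. -/
noncomputable def nll (O : τ → Finset ι) (f : τ → ι → E) (c : τ → ι) (lam : ℝ) (θ : E) : ℝ :=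
  ∑ m, (Real.log (partitionSum (O m) (f m) θ) - ⟪f m (c m), θ⟫) + lam / 2 * ‖θ‖ ^ 2

/-- The gradient of the penalized negative log-likelihood. -/
noncomputable def score (O : τ → Finset ι) (f : τ → ι → E) (c : τ → ι) (lam : ℝ) (θ : E) : E :=
  ∑ m, (softmaxMean (O m) (f m) θ - f m (c m)) + lam • θ

/-- The information operator, which is the Hessian of the penalized negative log-likelihood.
It does not depend on the choices. -/
noncomputable def info (O : τ → Finset ι) (f : τ → ι → E) (lam : ℝ) (θ : E) : E →L[ℝ] E :=
  ∑ m, softmaxCov (O m) (f m) θ + lam • ContinuousLinearMap.id ℝ E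

variable {O : τ → Finset ι} {f : τ → ι → E} {c : τ → ι} {lam : ℝ}

lemma hasFDerivAt_nll (hO : ∀ m, (O m).Nonempty) (θ : E) :
    HasFDerivAt (nll O f c lam) (innerSL ℝ (score O f c lam θ)) θ := by
  have h1 : HasFDerivAt
      (fun η => ∑ m, (Real.log (partitionSum (O m) (f m) η) - ⟪f m (c m), η⟫))
      (∑ m, (innerSL ℝ (softmaxMean (O m) (f m) θ) - innerSL ℝ (f m (c m)))) θ :=
    HasFDerivAt.fun_sum fun m _ => (hasFDerivAt_log_partitionSum (hO m) θ).sub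
      ((innerSL ℝ (f m (c m))).hasFDerivAt (x := θ))
  have h2 : HasFDerivAt (fun η : E => lam / 2 * ‖η‖ ^ 2) ((lam / 2) • (2 • innerSL ℝ θ)) θ :=
    (hasStrictFDerivAt_norm_sq θ).hasFDerivAt.const_mul (lam / 2)
  refine (h1.add h2).congr_fderiv ?_
  ext u
  simp [score]
  ring

lemma hasFDerivAt_score (hO : ∀ m, (O m).Nonempty) (θ : E) :
    HasFDerivAt (score O f c lam) (info O f lam θ) θ := by
  have h1 : HasFDerivAt (fun η => ∑ m, (softmaxMean (O m) (f m) η - f m (c m)))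
      (∑ m, softmaxCov (O m) (f m) θ) θ :=
    HasFDerivAt.fun_sum fun m _ => (hasFDerivAt_softmaxMean (hO m) θ).sub_const _
  exact h1.add ((hasFDerivAt_id θ).const_smul lam)

lemma inner_info (θ u v : E) :
    ⟪info O f lam θ u, v⟫ = ∑ m, ⟪softmaxCov (O m) (f m) θ u, v⟫ + lam * ⟪u, v⟫ := by
  simp [info, inner_add_left, sum_inner, real_inner_smul_left]

lemma inner_info_comm (θ u v : E) : ⟪info O f lam θ u, v⟫ = ⟪info O f lam θ v, u⟫ := by
  rw [inner_info, inner_info, real_inner_comm v u]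
  congr 1
  refine Finset.sum_congr rfl fun m _ => ?_
  rw [inner_softmaxCov, inner_softmaxCov]
  refine Finset.sum_congr rfl fun o _ => ?_
  ring

lemma lam_mul_le_inner_info (hO : ∀ m, (O m).Nonempty) (θ u : E) :
    lam * ‖u‖ ^ 2 ≤ ⟪info O f lam θ u, u⟫ := by
  rw [inner_info, real_inner_self_eq_norm_sq]
  have := Finset.sum_nonneg fun m (_ : m ∈ Finset.univ) =>
    inner_softmaxCov_self_nonneg (f := f m) (hO m) θ u
  linarith

/-- Self-concordance of the penalized likelihood. -/
lemma inner_info_add_le (hO : ∀ m, (O m).Nonempty) (hlam : 0 ≤ lam) (θ u w : E) {s : ℝ}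
    (hs0 : 0 ≤ s) (hs : ∀ m, ∀ o ∈ O m, |⟪f m o, u⟫| ≤ s) :
    ⟪info O f lam (θ + u) w, w⟫ ≤ Real.exp (2 * s) * ⟪info O f lam θ w, w⟫ := by
  rw [inner_info, inner_info, mul_add, Finset.mul_sum]
  refine add_le_add (Finset.sum_le_sum fun m _ => softmaxCov_add_le (hO m) θ u w (hs m)) ?_
  refine le_mul_of_one_le_left ?_ (Real.one_le_exp (by linarith))
  exact mul_nonneg hlam real_inner_self_nonneg

lemma le_inner_info_add (hO : ∀ m, (O m).Nonempty) (hlam : 0 ≤ lam) (θ u w : E) {s : ℝ}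
    (hs0 : 0 ≤ s) (hs : ∀ m, ∀ o ∈ O m, |⟪f m o, u⟫| ≤ s) :
    ⟪info O f lam θ w, w⟫ ≤ Real.exp (2 * s) * ⟪info O f lam (θ + u) w, w⟫ := by
  have := inner_info_add_le (f := f) hO hlam (θ + u) (-u) w hs0
    (fun m o ho => by simpa using hs m o ho)
  simpa using this

/-- Mean value theorem for the gradient tested against a fixed vector. -/
lemma exists_inner_score_sub (hO : ∀ m, (O m).Nonempty) (θ u v : E) :
    ∃ a ∈ Set.Ioo (0 : ℝ) 1,
      ⟪score O f c lam (θ + u) - score O f c lam θ, v⟫ = ⟪info O f lam (θ + a • u) u, v⟫ := by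
  have hd : ∀ a : ℝ, HasDerivAt (fun a : ℝ => ⟪score O f c lam (θ + a • u), v⟫)
      ⟪info O f lam (θ + a • u) u, v⟫ a := by
    intro a
    have h1 : HasDerivAt (fun a : ℝ => θ + a • u) u a := by
      simpa using ((hasDerivAt_id a).smul_const u).const_add θ
    have h2 := (hasFDerivAt_score (f := f) (c := c) (lam := lam) hO (θ + a • u)).comp_hasDerivAt a h1
    simpa using h2.inner ℝ (hasDerivAt_const a v)
  obtain ⟨a, ha, h⟩ := exists_hasDerivAt_eq_slope _ _ zero_lt_one
    (fun a _ => (hd a).continuousAt.continuousWithinAt) (fun a _ => hd a)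
  exact ⟨a, ha, by rw [h, inner_sub_left]; simp⟩

lemma hasDerivAt_nll_line (hO : ∀ m, (O m).Nonempty) (θ u : E) (a : ℝ) :
    HasDerivAt (fun a : ℝ => nll O f c lam (θ + a • u))
      ⟪score O f c lam (θ + a • u), u⟫ a := by
  have h1 : HasDerivAt (fun a : ℝ => θ + a • u) u a := by
    simpa using ((hasDerivAt_id a).smul_const u).const_add θ
  exact (hasFDerivAt_nll (f := f) (c := c) (lam := lam) hO (θ + a • u)).comp_hasDerivAt a h1

lemma exists_nll_sub (hO : ∀ m, (O m).Nonempty) (θ u : E) :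
    ∃ a ∈ Set.Ioo (0 : ℝ) 1,
      nll O f c lam (θ + u) - nll O f c lam θ = ⟪score O f c lam (θ + a • u), u⟫ := by
  have hd := hasDerivAt_nll_line (f := f) (c := c) (lam := lam) hO θ u
  obtain ⟨a, ha, h⟩ := exists_hasDerivAt_eq_slope _ _ zero_lt_one
    (fun a _ => (hd a).continuousAt.continuousWithinAt) (fun a _ => hd a)
  exact ⟨a, ha, by rw [h]; simp⟩

end Rounds

/-! ### Localization of the minimizer -/

section Localization

/-- Cauchy–Schwarz for a symmetric operator `S` whose quadratic form is dominated by that of a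
positive definite operator `H`. -/
lemma abs_inner_le_of_abs_inner_self_le {E : Type*} [NormedAddCommGroup E] [InnerProductSpace ℝ E]
    {H S : E →L[ℝ] E} (hpos : ∀ u, u ≠ 0 → 0 < ⟪H u, u⟫)
    (hHsymm : ∀ u v, ⟪H u, v⟫ = ⟪H v, u⟫) (hsymm : ∀ u v, ⟪S u, v⟫ = ⟪S v, u⟫) {k : ℝ}
    (hS : ∀ u, |⟪S u, u⟫| ≤ k * ⟪H u, u⟫) (u v : E) :
    |⟪S u, v⟫| ≤ k * (√⟪H u, u⟫ * √⟪H v, v⟫) := by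
  rcases eq_or_ne u 0 with rfl | hu
  · simp
  rcases eq_or_ne v 0 with rfl | hv
  · simp
  have key : ∀ x y : E, 2 * |⟪S x, y⟫| ≤ k * (⟪H x, x⟫ + ⟪H y, y⟫) := by
    intro x y
    -- polarization
    have e1 : ⟪S (x + y), x + y⟫ - ⟪S (x - y), x - y⟫ = 4 * ⟪S x, y⟫ := by
      simp only [map_add, map_sub, inner_add_left, inner_add_right, inner_sub_left,
        inner_sub_right, hsymm y x]
      ring
    have e2 : ⟪H (x + y), x + y⟫ + ⟪H (x - y), x - y⟫ = 2 * (⟪H x, x⟫ + ⟪H y, y⟫) := by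
      simp only [map_add, map_sub, inner_add_left, inner_add_right, inner_sub_left,
        inner_sub_right, hHsymm y x]
      ring
    have h1 := hS (x + y)
    have h2 := hS (x - y)
    have h3 : |4 * ⟪S x, y⟫| ≤ k * (2 * (⟪H x, x⟫ + ⟪H y, y⟫)) := by
      rw [← e1, ← e2, mul_add]
      exact (abs_sub _ _).trans (add_le_add h1 h2)
    rw [abs_mul, abs_of_pos (by norm_num : (0 : ℝ) < 4)] at h3
    linarith
  have ha : 0 < √⟪H u, u⟫ := Real.sqrt_pos.2 (hpos u hu)
  have hb : 0 < √⟪H v, v⟫ := Real.sqrt_pos.2 (hpos v hv)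
  have hua := Real.sq_sqrt (hpos u hu).le
  have hvb := Real.sq_sqrt (hpos v hv).le
  set a := √⟪H u, u⟫
  set b := √⟪H v, v⟫
  have h := key (a⁻¹ • u) (b⁻¹ • v)
  simp only [map_smul, real_inner_smul_left, real_inner_smul_right, ← hua, ← hvb] at h
  rw [abs_mul, abs_mul, abs_of_pos (inv_pos.2 ha), abs_of_pos (inv_pos.2 hb)] at h
  have e : a⁻¹ * (a⁻¹ * a ^ 2) + b⁻¹ * (b⁻¹ * b ^ 2) = 2 := by field_simp; norm_num
  rw [e] at h
  have h' : b⁻¹ * (a⁻¹ * |⟪S u, v⟫|) ≤ k := by linarith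
  calc |⟪S u, v⟫| = (b⁻¹ * (a⁻¹ * |⟪S u, v⟫|)) * (a * b) := by field_simp
    _ ≤ k * (a * b) := by gcongr

variable {E : Type*} [NormedAddCommGroup E] [InnerProductSpace ℝ E]

/-- The norm `√(aᵀ P a)`, used with `P` the inverse of the information operator. -/
noncomputable def dualNorm (P : E →L[ℝ] E) (a : E) : ℝ := √⟪a, P a⟫

lemma dualNorm_nonneg (P : E →L[ℝ] E) (a : E) : 0 ≤ dualNorm P a := Real.sqrt_nonneg _

lemma abs_inner_le_dualNorm {H P : E →L[ℝ] E} (hpos : ∀ u, u ≠ 0 → 0 < ⟪H u, u⟫)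
    (hsymm : ∀ u v, ⟪H u, v⟫ = ⟪H v, u⟫) (hHP : ∀ a, H (P a) = a) (a u : E) :
    |⟪a, u⟫| ≤ dualNorm P a * √⟪H u, u⟫ := by
  have hnn : ∀ u, 0 ≤ ⟪H u, u⟫ := fun u => by
    rcases eq_or_ne u 0 with rfl | hu
    · simp
    · exact (hpos u hu).le
  have := abs_inner_le_of_abs_inner_self_le (k := 1) hpos hsymm hsymm
    (fun u => by rw [one_mul, abs_of_nonneg (hnn u)]) (P a) u
  rwa [hHP, one_mul] at this

variable {τ ι : Type*} [Fintype τ] {O : τ → Finset ι} {f : τ → ι → E} {c : τ → ι} {lam : ℝ}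

lemma exists_max_abs_inner (O : τ → Finset ι) (f : τ → ι → E) (u : E) :
    ∃ s : ℝ, 0 ≤ s ∧ (∀ m, ∀ o ∈ O m, |⟪f m o, u⟫| ≤ s) ∧
      (s = 0 ∨ ∃ m, ∃ o ∈ O m, |⟪f m o, u⟫| = s) := by
  classical
  rcases (Finset.univ.sigma O).eq_empty_or_nonempty with h | h
  · refine ⟨0, le_rfl, fun m o ho => ?_, Or.inl rfl⟩
    have : (⟨m, o⟩ : Σ _ : τ, ι) ∈ Finset.univ.sigma O := by simpa using ho
    simp [h] at this
  · obtain ⟨⟨m, o⟩, hmo, hmax⟩ := Finset.exists_max_image _ (fun z => |⟪f z.1 z.2, u⟫|) h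
    exact ⟨|⟪f m o, u⟫|, abs_nonneg _, fun m' o' ho' => hmax ⟨m', o'⟩ (by simpa using ho'),
      Or.inr ⟨m, o, by simpa using hmo, rfl⟩⟩

lemma inner_info_pos (hO : ∀ m, (O m).Nonempty) (hlam : 0 ≤ lam) {θs : E}
    (hpos : ∀ u, u ≠ 0 → 0 < ⟪info O f lam θs u, u⟫) (θ u : E) (hu : u ≠ 0) :
    0 < ⟪info O f lam θ u, u⟫ := by
  obtain ⟨s, hs0, hs, -⟩ := exists_max_abs_inner O f (θ - θs)
  have h := le_inner_info_add hO hlam θs (θ - θs) u hs0 hs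
  rw [add_sub_cancel] at h
  exact pos_of_mul_pos_right ((hpos u hu).trans_le h) (Real.exp_pos _).le

/-- A critical point of the strictly convex penalized likelihood is its strict global minimizer. -/
lemma nll_lt_of_score_eq_zero (hO : ∀ m, (O m).Nonempty)
    (hpos : ∀ θ u, u ≠ 0 → 0 < ⟪info O f lam θ u, u⟫) {θ η : E}
    (hθ : score O f c lam θ = 0) (hne : η ≠ θ) : nll O f c lam θ < nll O f c lam η := by
  obtain ⟨a, ha, h⟩ := exists_nll_sub (f := f) (c := c) (lam := lam) hO θ (η - θ)
  obtain ⟨b, -, h'⟩ := exists_inner_score_sub (f := f) (c := c) (lam := lam) hO θ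
    (a • (η - θ)) (η - θ)
  rw [hθ, sub_zero] at h'
  rw [h', map_smul, real_inner_smul_left, add_sub_cancel] at h
  have := mul_pos ha.1 (hpos (θ + b • a • (η - θ)) (η - θ) (sub_ne_zero.2 hne))
  linarith

lemma exp_two_mul_le {s : ℝ} (hs0 : 0 ≤ s) (hs : s ≤ 1 / 4) : Real.exp (2 * s) ≤ 1 + 3 * s := by
  have h := Real.abs_exp_sub_one_sub_id_le (x := 2 * s) (by rw [abs_le]; constructor <;> linarith)
  nlinarith [le_abs_self (Real.exp (2 * s) - 1 - 2 * s)]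

/-- Deterministic core of the argument. If the score at `θs` has dual norm at most `r`, the
features are small in dual norm compared with `1 / r`, and the score is of size `A` along each
feature, then the penalized likelihood has its minimizer within distance `2 r` of `θs` in the
information norm, and the linearization error of the estimator along any direction is controlled
by `A` alone. The last point uses the directional bound for the features once more: it bounds the
movement of the utilities, and hence the change of the Hessian, without the dimension factor that
is hidden in `r`. -/
theorem exists_minimizer_of_score_bounds [FiniteDimensional ℝ E] (hO : ∀ m, (O m).Nonempty)
    (hlam : 0 ≤ lam) {θs : E} (hpos : ∀ u, u ≠ 0 → 0 < ⟪info O f lam θs u, u⟫)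
    {P : E →L[ℝ] E} (hHP : ∀ a, info O f lam θs (P a) = a) {r A : ℝ} (hr : 0 < r) (hA : 0 ≤ A)
    (hscore : dualNorm P (score O f c lam θs) ≤ r)
    (hf : ∀ m, ∀ o ∈ O m, dualNorm P (f m o) * r ≤ 5 / 72)
    (hfA : ∀ m, ∀ o ∈ O m, |⟪score O f c lam θs, P (f m o)⟫| ≤ dualNorm P (f m o) * A) :
    ∃ θh : E, (∀ η, η ≠ θh → nll O f c lam θh < nll O f c lam η) ∧
      (∀ u, ⟪info O f lam θs u, u⟫ ≤ 3 * ⟪info O f lam θh u, u⟫) ∧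
      (∀ u, ⟪info O f lam θh u, u⟫ ≤ 3 * ⟪info O f lam θs u, u⟫) ∧
      ∀ a, |⟪a, θh - θs⟫| ≤ |⟪score O f c lam θs, P a⟫| + dualNorm P a * (5 / 7 * A) := by
  set H := info O f lam θs with hH
  have hsymm : ∀ u v, ⟪H u, v⟫ = ⟪H v, u⟫ := inner_info_comm θs
  have hnn : ∀ u, 0 ≤ ⟪H u, u⟫ := fun u => by
    rcases eq_or_ne u 0 with rfl | hu
    · simp
    · exact (hpos u hu).le
  have hdual := abs_inner_le_dualNorm hpos hsymm hHP
  have hpos' := inner_info_pos hO hlam hpos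
  have hsmul : ∀ (a : ℝ) (u : E), ⟪H (a • u), a • u⟫ = a ^ 2 * ⟪H u, u⟫ := fun a u => by
    rw [map_smul, real_inner_smul_left, real_inner_smul_right]; ring
  set K : Set E := {u | ⟪H u, u⟫ ≤ (2 * r) ^ 2} with hK
  have hKs : ∀ u ∈ K, √⟪H u, u⟫ ≤ 2 * r := fun u hu => Real.sqrt_le_iff.2 ⟨by positivity, hu⟩
  have hsK : ∀ u ∈ K, ∀ m, ∀ o ∈ O m, |⟪f m o, u⟫| ≤ 5 / 36 := fun u hu m o ho => by
    have h1 := hdual (f m o) u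
    have h2 := mul_le_mul_of_nonneg_left (hKs u hu) (dualNorm_nonneg P (f m o))
    linarith [hf m o ho]
  -- on the ellipsoid the utilities move by at most `2 * (5 / 72)`, so the Hessian loses at most
  -- this factor
  have hexp : Real.exp (2 * (5 / 36)) ≤ 17 / 12 :=
    (exp_two_mul_le (by norm_num) (by norm_num)).trans (by norm_num)
  have hQcont : Continuous fun u => ⟪H u, u⟫ := H.continuous.inner continuous_id
  have hKsmul : ∀ u ∈ K, ∀ a ∈ Set.Ioo (0 : ℝ) 1, a • u ∈ K := fun u hu a ha => by
    change ⟪H (a • u), a • u⟫ ≤ _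
    rw [hsmul]
    have : a ^ 2 ≤ 1 := by nlinarith [ha.1, ha.2]
    nlinarith [hnn u, show ⟪H u, u⟫ ≤ (2 * r) ^ 2 from hu]
  -- outward growth of the gradient
  have hgrow : ∀ u ∈ K, 12 / 17 * ⟪H u, u⟫ - r * √⟪H u, u⟫ ≤ ⟪score O f c lam (θs + u), u⟫ := by
    intro u hu
    obtain ⟨a, ha, h⟩ := exists_inner_score_sub (f := f) (c := c) (lam := lam) hO θs u u
    have h1 := le_inner_info_add hO hlam θs (a • u) u (by norm_num) (hsK _ (hKsmul u hu a ha))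
    have h2 := mul_le_mul_of_nonneg_right hexp
      (show 0 ≤ ⟪info O f lam (θs + a • u) u, u⟫ by
        rcases eq_or_ne u 0 with rfl | hu
        · simp
        · exact (hpos' _ u hu).le)
    have h3 := hdual (score O f c lam θs) u
    have h4 := mul_le_mul_of_nonneg_right hscore (Real.sqrt_nonneg ⟪H u, u⟫)
    rw [inner_sub_left] at h
    have h5 := neg_abs_le ⟪score O f c lam θs, u⟫
    linarith
  -- the ellipsoid is compact
  have hKc : IsCompact K := by
    refine Metric.isCompact_of_isClosed_isBounded (isClosed_le hQcont continuous_const) ?_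
    refine (Metric.isBounded_iff_subset_closedBall 0).2 ⟨√‖P‖ * (2 * r), fun u hu => ?_⟩
    rw [mem_closedBall_zero_iff]
    have h1 := hdual u u
    rw [real_inner_self_eq_norm_sq, abs_of_nonneg (sq_nonneg _)] at h1
    have h2 : dualNorm P u ≤ √‖P‖ * ‖u‖ := by
      rw [dualNorm, Real.sqrt_le_left (by positivity), mul_pow, Real.sq_sqrt (norm_nonneg _)]
      calc ⟪u, P u⟫ ≤ ‖u‖ * ‖P u‖ := real_inner_le_norm _ _
        _ ≤ ‖u‖ * (‖P‖ * ‖u‖) := by gcongr; exact P.le_opNorm u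
        _ = _ := by ring
    rcases (norm_nonneg u).eq_or_lt with h0 | h0
    · rw [← h0]; positivity
    have h3 : ‖u‖ * ‖u‖ ≤ √‖P‖ * (2 * r) * ‖u‖ := by
      calc ‖u‖ * ‖u‖ = ‖u‖ ^ 2 := by ring
        _ ≤ dualNorm P u * √⟪H u, u⟫ := h1
        _ ≤ (√‖P‖ * ‖u‖) * (2 * r) :=
          mul_le_mul h2 (hKs u hu) (Real.sqrt_nonneg _) (by positivity)
        _ = _ := by ring
    exact le_of_mul_le_mul_right h3 h0
  have hcont : Continuous fun u => nll O f c lam (θs + u) :=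
    (continuous_iff_continuousAt.2 fun θ =>
      (hasFDerivAt_nll (f := f) (c := c) (lam := lam) hO θ).continuousAt).comp
      (continuous_const.add continuous_id)
  obtain ⟨u, huK, hmin⟩ := hKc.exists_isMinOn ⟨0, by simp [hK]; positivity⟩ hcont.continuousOn
  have hint : ⟪H u, u⟫ < (2 * r) ^ 2 := by
    refine lt_of_le_of_ne huK fun heq => ?_
    -- on the boundary of the ellipsoid the value decreases towards the centre: along the segment
    -- from `5 / 6` to `1` the growth bound is positive, as `48 / 17 * b > 2` there
    obtain ⟨b, hb, h⟩ := exists_hasDerivAt_eq_slope _ _ (show (5 / 6 : ℝ) < 1 by norm_num)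
      (fun a _ => (hasDerivAt_nll_line (f := f) (c := c) (lam := lam) hO
        θs u a).continuousAt.continuousWithinAt) (fun a _ => hasDerivAt_nll_line hO θs u a)
    have hb0 : 0 < b := by linarith [hb.1]
    have h1 := hgrow (b • u) (hKsmul u huK b ⟨hb0, hb.2⟩)
    rw [hsmul, heq, real_inner_smul_right, ← mul_pow, Real.sqrt_sq (by positivity)] at h1
    have h2 : 0 < b * ⟪score O f c lam (θs + b • u), u⟫ := by
      refine lt_of_lt_of_le ?_ h1
      have : 0 < b * r ^ 2 * (48 / 17 * b - 2) := by
        have : 0 < 48 / 17 * b - 2 := by linarith [hb.1]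
        positivity
      nlinarith
    have h3 : nll O f c lam (θs + u) ≤ nll O f c lam (θs + (5 / 6 : ℝ) • u) :=
      hmin (hKsmul u huK (5 / 6) ⟨by norm_num, by norm_num⟩)
    rw [one_smul] at h
    have h4 := pos_of_mul_pos_right h2 hb0.le
    rw [h] at h4
    have h5 : (nll O f c lam (θs + u) - nll O f c lam (θs + (5 / 6 : ℝ) • u)) / (1 - 5 / 6) ≤ 0 :=
      div_nonpos_of_nonpos_of_nonneg (by linarith) (by norm_num)
    linarith
  have hcrit : score O f c lam (θs + u) = 0 := by
    have hloc : IsLocalMin (fun u => nll O f c lam (θs + u)) u :=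
      hmin.isLocalMin (Filter.mem_of_superset
        ((isOpen_lt hQcont continuous_const).mem_nhds hint) fun v hv =>
          le_of_lt (show ⟪H v, v⟫ < (2 * r) ^ 2 from hv))
    have hd : HasFDerivAt (fun u => nll O f c lam (θs + u))
        (innerSL ℝ (score O f c lam (θs + u))) u :=
      (hasFDerivAt_comp_add_left θs).2
        (hasFDerivAt_nll (f := f) (c := c) (lam := lam) hO (θs + u))
    have h0 := congrArg (fun g => g (score O f c lam (θs + u))) (hloc.hasFDerivAt_eq_zero hd)
    simpa using h0
  obtain ⟨s, hs0, hs, hs_att⟩ := exists_max_abs_inner O f u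
  have hs36 : s ≤ 5 / 36 := by
    rcases hs_att with h | ⟨m, o, ho, h⟩
    · linarith
    · rw [← h]; exact hsK u huK m o ho
  have hes := exp_two_mul_le hs0 (by linarith)
  -- error of the linearization of the gradient along `a`
  have herr : ∀ a, |⟪a, u⟫| ≤ |⟪score O f c lam θs, P a⟫| + dualNorm P a * (6 * s * r) := by
    intro a
    obtain ⟨b, hb, h⟩ := exists_inner_score_sub (f := f) (c := c) (lam := lam) hO θs u (P a)
    rw [hcrit, zero_sub, inner_neg_left] at h
    have hsb : ∀ m, ∀ o ∈ O m, |⟪f m o, b • u⟫| ≤ s := fun m o ho => by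
      rw [real_inner_smul_right, abs_mul, abs_of_pos hb.1]
      exact (mul_le_of_le_one_left (abs_nonneg _) hb.2.le).trans (hs m o ho)
    set H' := info O f lam (θs + b • u) with hH'
    have hsymm' : ∀ u v, ⟪H' u, v⟫ = ⟪H' v, u⟫ := inner_info_comm _
    have hT : ∀ w, |⟪(H' - H) w, w⟫| ≤ 3 * s * ⟪H w, w⟫ := by
      intro w
      have h1 := inner_info_add_le hO hlam θs (b • u) w hs0 hsb
      have h2 := le_inner_info_add hO hlam θs (b • u) w hs0 hsb
      rw [← hH, ← hH'] at h1 h2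
      have h3 := hnn w
      rw [_root_.sub_apply, inner_sub_left, abs_le]
      have h4 : 0 ≤ ⟪H' w, w⟫ := by
        rcases eq_or_ne w 0 with rfl | hw
        · simp
        · exact (hpos' _ w hw).le
      constructor
      · have h5 := h2.trans (mul_le_mul_of_nonneg_right hes h4)
        by_cases h6 : ⟪H w, w⟫ ≤ ⟪H' w, w⟫
        · have := mul_nonneg (mul_nonneg (by norm_num : (0:ℝ) ≤ 3) hs0) h3
          linarith
        · have := mul_le_mul_of_nonneg_left (not_le.1 h6).le
            (mul_nonneg (by norm_num : (0:ℝ) ≤ 3) hs0)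
          linarith
      · nlinarith [mul_le_mul_of_nonneg_right hes h3]
    have h1 := abs_inner_le_of_abs_inner_self_le hpos hsymm
      (fun x y => by
        rw [_root_.sub_apply, _root_.sub_apply, inner_sub_left, inner_sub_left, hsymm x y,
          hsymm' x y]) hT u (P a)
    have h2 : ⟪a, u⟫ = -⟪score O f c lam θs, P a⟫ - ⟪(H' - H) u, P a⟫ := by
      rw [_root_.sub_apply, inner_sub_left, ← h, hsymm u (P a), hHP]; ring
    have h3 : √⟪H (P a), P a⟫ = dualNorm P a := by rw [hHP, dualNorm]
    rw [h3] at h1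
    have h4 : 3 * s * (√⟪H u, u⟫ * dualNorm P a) ≤ dualNorm P a * (6 * s * r) := by
      have := mul_le_mul_of_nonneg_left (hKs u huK)
        (mul_nonneg hs0 (dualNorm_nonneg P a))
      linarith
    rw [h2]
    calc _ ≤ |-⟪score O f c lam θs, P a⟫| + |⟪(H' - H) u, P a⟫| := abs_sub _ _
      _ ≤ _ := by rw [abs_neg]; linarith
  -- the largest change of a utility is itself bounded through the directional bound
  have hsr : 6 * s * r ≤ 5 / 7 * A := by
    rcases hs_att with h | ⟨m, o, ho, h⟩
    · rw [h]; nlinarith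
    · have h1 := herr (f m o)
      rw [h] at h1
      have h2 := hfA m o ho
      have h3 := hf m o ho
      have h4 := mul_le_mul_of_nonneg_right h3 hs0
      -- the error term `6 s r ‖f m o‖` is at most `5 / 12 * s` and is absorbed
      have h5 : s ≤ 12 / 7 * (dualNorm P (f m o) * A) := by nlinarith
      have h6 := mul_le_mul_of_nonneg_right h3 hA
      nlinarith
  refine ⟨θs + u, fun η hη => nll_lt_of_score_eq_zero hO hpos' hcrit hη, fun w => ?_, fun w => ?_,
    fun a => ?_⟩
  · have h2 := le_inner_info_add hO hlam θs u w hs0 hs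
    refine h2.trans (mul_le_mul_of_nonneg_right (by linarith) ?_)
    rcases eq_or_ne w 0 with rfl | hw
    · simp
    · exact (hpos' _ w hw).le
  · exact (inner_info_add_le hO hlam θs u w hs0 hs).trans
      (mul_le_mul_of_nonneg_right (by linarith) (hnn w))
  · rw [add_sub_cancel_left]
    exact (herr a).trans (by gcongr; exact dualNorm_nonneg P a)

end Localization

/-! ### Concentration under finite product distributions -/

section Pinelis

variable {F : Type*} [NormedAddCommGroup F] [InnerProductSpace ℝ F]

/-- Convexity of `u ↦ cosh √u`, which holds because its power series has nonnegative
coefficients. -/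
lemma cosh_le_of_sq_eq_convex_comb {x y z a b : ℝ} (ha : 0 ≤ a) (hb : 0 ≤ b) (hab : a + b = 1)
    (h : x ^ 2 = a * y ^ 2 + b * z ^ 2) :
    Real.cosh x ≤ a * Real.cosh y + b * Real.cosh z := by
  refine hasSum_le (fun k => ?_) (Real.hasSum_cosh x)
    (((Real.hasSum_cosh y).mul_left a).add ((Real.hasSum_cosh z).mul_left b))
  have hc := (convexOn_pow k).2 (show y ^ 2 ∈ Set.Ici (0 : ℝ) from sq_nonneg y)
    (show z ^ 2 ∈ Set.Ici (0 : ℝ) from sq_nonneg z) ha hb hab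
  simp only [smul_eq_mul, ← h] at hc
  rw [pow_mul, pow_mul, pow_mul, mul_div_assoc', mul_div_assoc', ← add_div]
  gcongr

/-- The norm of `s + v` interpolates between `‖s‖ + ‖v‖` and `‖s‖ - ‖v‖` according to the angle
between `s` and `v`. The quotients vanish when a norm does, and so does the inner product. -/
lemma cosh_norm_add_le (s v : F) :
    Real.cosh ‖s + v‖ ≤ Real.cosh ‖s‖ * Real.cosh ‖v‖ +
      ⟪s, v⟫ * (Real.sinh ‖s‖ / ‖s‖) * (Real.sinh ‖v‖ / ‖v‖) := by
  rcases eq_or_ne s 0 with rfl | hs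
  · simp
  rcases eq_or_ne v 0 with rfl | hv
  · simp
  have hs' : 0 < ‖s‖ := norm_pos_iff.2 hs
  have hv' : 0 < ‖v‖ := norm_pos_iff.2 hv
  set r := ⟪s, v⟫ / (‖s‖ * ‖v‖) with hr
  have hr1 : |r| ≤ 1 := abs_real_inner_div_norm_mul_norm_le_one s v
  have hin : ⟪s, v⟫ = r * (‖s‖ * ‖v‖) := by rw [hr]; field_simp
  have h := cosh_le_of_sq_eq_convex_comb (x := ‖s + v‖) (y := ‖s‖ + ‖v‖) (z := ‖s‖ - ‖v‖)
    (a := (1 + r) / 2) (b := (1 - r) / 2) (by linarith [neg_abs_le r]) (by linarith [le_abs_self r])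
    (by ring) (by rw [norm_add_sq_real, hin]; ring)
  rw [Real.cosh_add, Real.cosh_sub] at h
  refine h.trans (le_of_eq ?_)
  rw [hin]
  field_simp
  ring

/-- One step of Pinelis' exponential supermartingale in a Hilbert space. -/
lemma cosh_norm_add_le_of_norm_le_one (s v : F) (hv : ‖v‖ ≤ 1) :
    Real.cosh ‖s + v‖ ≤ Real.cosh ‖s‖ * (1 + ‖v‖ ^ 2) + ⟪(Real.sinh ‖s‖ / ‖s‖) • s, v⟫ := by
  refine (cosh_norm_add_le s v).trans ?_
  rw [real_inner_smul_left]
  have hexp : Real.cosh ‖v‖ + Real.sinh ‖v‖ - ‖v‖ ≤ 1 + ‖v‖ ^ 2 := by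
    rw [Real.cosh_add_sinh]
    have := Real.abs_exp_sub_one_sub_id_le (x := ‖v‖) (by rwa [abs_norm])
    linarith [le_abs_self (Real.exp ‖v‖ - 1 - ‖v‖)]
  have hc := Real.cosh_pos ‖s‖
  have h1 := mul_le_mul_of_nonneg_left hexp hc.le
  suffices h : ⟪s, v⟫ * (Real.sinh ‖s‖ / ‖s‖) * (Real.sinh ‖v‖ / ‖v‖) ≤
      Real.sinh ‖s‖ / ‖s‖ * ⟪s, v⟫ + Real.cosh ‖s‖ * (Real.sinh ‖v‖ - ‖v‖) by linarith
  rcases eq_or_ne s 0 with rfl | hs0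
  · simp
  rcases eq_or_ne v 0 with rfl | hv0
  · simp
  have hs' : 0 < ‖s‖ := norm_pos_iff.2 hs0
  have hv' : 0 < ‖v‖ := norm_pos_iff.2 hv0
  have h2 : ‖v‖ ≤ Real.sinh ‖v‖ := Real.self_le_sinh_iff.2 hv'.le
  have h3 : 0 < Real.sinh ‖s‖ := Real.sinh_pos_iff.2 hs'
  have h4 : ⟪s, v⟫ ≤ ‖s‖ * ‖v‖ := real_inner_le_norm s v
  calc ⟪s, v⟫ * (Real.sinh ‖s‖ / ‖s‖) * (Real.sinh ‖v‖ / ‖v‖)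
      = Real.sinh ‖s‖ / ‖s‖ * ⟪s, v⟫ +
        ⟪s, v⟫ * ((Real.sinh ‖s‖ / ‖s‖) * ((Real.sinh ‖v‖ - ‖v‖) / ‖v‖)) := by
        field_simp
        ring
    _ ≤ Real.sinh ‖s‖ / ‖s‖ * ⟪s, v⟫ +
        (‖s‖ * ‖v‖) * ((Real.sinh ‖s‖ / ‖s‖) * ((Real.sinh ‖v‖ - ‖v‖) / ‖v‖)) := by
        gcongr
    _ = Real.sinh ‖s‖ / ‖s‖ * ⟪s, v⟫ + Real.sinh ‖s‖ * (Real.sinh ‖v‖ - ‖v‖) := by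
        field_simp
    _ ≤ _ := by
        gcongr
        exact (Real.sinh_lt_cosh _).le

end Pinelis

section ProductWeights

variable {ι : Type*} [Fintype ι] {t : ℕ}

/-- The probability of the event `B` when the coordinates `c m` are independent with
distributions `w m`. -/
noncomputable def prodProb (w : Fin t → ι → ℝ) (B : Set (Fin t → ι)) : ℝ :=
  ∑ c, B.indicator (fun c => ∏ m, w m (c m)) c

variable {w : Fin t → ι → ℝ}

lemma sum_prod_weights (hw1 : ∀ m, ∑ o, w m o = 1) : ∑ c : Fin t → ι, ∏ m, w m (c m) = 1 := by
  classical
  rw [← Fintype.piFinset_univ, ← Finset.prod_univ_sum]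
  simp [hw1]

lemma one_sub_prodProb_compl (hw1 : ∀ m, ∑ o, w m o = 1) (B : Set (Fin t → ι)) :
    1 - prodProb w Bᶜ = prodProb w B := by
  rw [sub_eq_iff_eq_add, prodProb, prodProb, ← Finset.sum_add_distrib, ← sum_prod_weights hw1]
  exact Finset.sum_congr rfl fun c _ => 
    (congrFun (Set.indicator_self_add_compl B fun c : Fin t → ι => ∏ m, w m (c m)) c).symm

lemma prodProb_le_sum_mul (hw0 : ∀ m o, 0 ≤ w m o) {B : Set (Fin t → ι)} {h : (Fin t → ι) → ℝ}
    (h0 : ∀ c, 0 ≤ h c) (h1 : ∀ c ∈ B, 1 ≤ h c) :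
    prodProb w B ≤ ∑ c, (∏ m, w m (c m)) * h c := by
  refine Finset.sum_le_sum fun c _ => ?_
  have hp : 0 ≤ ∏ m, w m (c m) := Finset.prod_nonneg fun m _ => hw0 m _
  by_cases hc : c ∈ B
  · rw [Set.indicator_of_mem hc]
    exact le_mul_of_one_le_right hp (h1 c hc)
  · rw [Set.indicator_of_notMem hc]
    exact mul_nonneg hp (h0 c)

lemma prodProb_le_of_imp (hw0 : ∀ m o, 0 ≤ w m o) {B B' : Set (Fin t → ι)}
    (h : ∀ c, (∀ m, w m (c m) ≠ 0) → c ∈ B → c ∈ B') : prodProb w B ≤ prodProb w B' := by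
  refine Finset.sum_le_sum fun c _ => ?_
  have hp : 0 ≤ ∏ m, w m (c m) := Finset.prod_nonneg fun m _ => hw0 m _
  by_cases hc : c ∈ B
  · rw [Set.indicator_of_mem hc]
    by_cases hw : ∀ m, w m (c m) ≠ 0
    · rw [Set.indicator_of_mem (h c hw hc)]
    · push Not at hw
      obtain ⟨m, hm⟩ := hw
      rw [Finset.prod_eq_zero (Finset.mem_univ m) hm]
      exact Set.indicator_nonneg (fun c _ => Finset.prod_nonneg fun m _ => hw0 m _) c
  · rw [Set.indicator_of_notMem hc]
    exact Set.indicator_nonneg (fun c _ => Finset.prod_nonneg fun m _ => hw0 m _) c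

lemma prodProb_union_le (hw0 : ∀ m o, 0 ≤ w m o) (B B' : Set (Fin t → ι)) :
    prodProb w (B ∪ B') ≤ prodProb w B + prodProb w B' := by
  rw [prodProb, prodProb, prodProb, ← Finset.sum_add_distrib]
  refine Finset.sum_le_sum fun c _ => ?_
  have := congrFun (Set.indicator_union_add_inter (fun c : Fin t → ι => ∏ m, w m (c m)) B B') c
  simp only [Pi.add_apply] at this
  rw [← this, le_add_iff_nonneg_right]
  exact Set.indicator_nonneg (fun c _ => Finset.prod_nonneg fun m _ => hw0 m _) c

lemma prodProb_empty : prodProb w ∅ = 0 := by simp [prodProb]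

lemma prodProb_iUnion_le (hw0 : ∀ m o, 0 ≤ w m o) {κ : Type*} (s : Finset κ)
    (B : κ → Set (Fin t → ι)) : prodProb w (⋃ k ∈ s, B k) ≤ ∑ k ∈ s, prodProb w (B k) := by
  classical
  induction s using Finset.induction_on with
  | empty => simp [prodProb_empty]
  | insert a s ha ih =>
    rw [Finset.set_biUnion_insert, Finset.sum_insert ha]
    exact (prodProb_union_le hw0 _ _).trans (by gcongr)

/-- Bernstein's exponential moment bound for a sum of independent centred variables that are
bounded by one on the support. -/
lemma sum_prod_mul_exp_sum_le (hw0 : ∀ m o, 0 ≤ w m o) (hw1 : ∀ m, ∑ o, w m o = 1)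
    {Y : Fin t → ι → ℝ} (hY : ∀ m o, w m o ≠ 0 → |Y m o| ≤ 1)
    (hmean : ∀ m, ∑ o, w m o * Y m o = 0) :
    ∑ c : Fin t → ι, (∏ m, w m (c m)) * Real.exp (∑ m, Y m (c m)) ≤
      Real.exp (∑ m, ∑ o, w m o * Y m o ^ 2) := by
  classical
  calc ∑ c : Fin t → ι, (∏ m, w m (c m)) * Real.exp (∑ m, Y m (c m))
      = ∏ m, ∑ o, w m o * Real.exp (Y m o) := by
        rw [Finset.prod_univ_sum, Fintype.piFinset_univ]
        refine Finset.sum_congr rfl fun c _ => ?_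
        rw [Real.exp_sum, Finset.prod_mul_distrib]
    _ ≤ ∏ m, Real.exp (∑ o, w m o * Y m o ^ 2) := by
        refine Finset.prod_le_prod
          (fun m _ => Finset.sum_nonneg fun o _ => mul_nonneg (hw0 m o) (Real.exp_pos _).le)
          fun m _ => ?_
        calc ∑ o, w m o * Real.exp (Y m o)
            ≤ ∑ o, (w m o + w m o * Y m o + w m o * Y m o ^ 2) := by
              refine Finset.sum_le_sum fun o _ => ?_
              by_cases h : w m o = 0
              · simp [h]
              · have h1 := Real.abs_exp_sub_one_sub_id_le (hY m o h)
                nlinarith [le_abs_self (Real.exp (Y m o) - 1 - Y m o), hw0 m o]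
          _ = 1 + ∑ o, w m o * Y m o ^ 2 := by
              rw [Finset.sum_add_distrib, Finset.sum_add_distrib, hw1, hmean, add_zero]
          _ ≤ _ := by rw [add_comm]; exact Real.add_one_le_exp _
    _ = _ := (Real.exp_sum _ _).symm

variable {F : Type*} [NormedAddCommGroup F] [InnerProductSpace ℝ F]

/-- Pinelis' inequality: the exponential moment of the norm of a sum of independent centred
vectors is controlled by their total variance. -/
lemma sum_prod_mul_cosh_norm_sum_le : ∀ {t : ℕ} {w : Fin t → ι → ℝ} {Y : Fin t → ι → F},
    (∀ m o, 0 ≤ w m o) → (∀ m, ∑ o, w m o = 1) → (∀ m o, w m o ≠ 0 → ‖Y m o‖ ≤ 1) →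
    (∀ m, ∑ o, w m o • Y m o = 0) → ∀ s : F,
    ∑ c : Fin t → ι, (∏ m, w m (c m)) * Real.cosh ‖s + ∑ m, Y m (c m)‖ ≤
      Real.cosh ‖s‖ * Real.exp (∑ m, ∑ o, w m o * ‖Y m o‖ ^ 2)
  | 0, w, Y, _, _, _, _, s => by simp
  | t + 1, w, Y, hw0, hw1, hY, hmean, s => by
    have ih := fun s => sum_prod_mul_cosh_norm_sum_le (w := fun m : Fin t => w m.succ)
      (Y := fun m => Y m.succ) (fun m o => hw0 _ o) (fun m => hw1 _) (fun m o => hY _ o)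
      (fun m => hmean _) s
    set V := ∑ m : Fin t, ∑ o, w m.succ o * ‖Y m.succ o‖ ^ 2 with hV
    calc ∑ c : Fin (t + 1) → ι, (∏ m, w m (c m)) * Real.cosh ‖s + ∑ m, Y m (c m)‖
        = ∑ o, w 0 o * ∑ c : Fin t → ι, (∏ m, w m.succ (c m)) *
            Real.cosh ‖(s + Y 0 o) + ∑ m, Y m.succ (c m)‖ := by
          rw [← (Fin.consEquiv fun _ => ι).sum_comp, Fintype.sum_prod_type]
          refine Finset.sum_congr rfl fun o _ => ?_
          rw [Finset.mul_sum]
          refine Finset.sum_congr rfl fun c _ => ?_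
          simp only [Fin.consEquiv_apply, Fin.prod_univ_succ, Fin.sum_univ_succ, Fin.cons_zero,
            Fin.cons_succ, add_assoc, mul_assoc]
      _ ≤ ∑ o, w 0 o * (Real.cosh ‖s + Y 0 o‖ * Real.exp V) :=
          Finset.sum_le_sum fun o _ => mul_le_mul_of_nonneg_left (ih _) (hw0 0 o)
      _ = (∑ o, w 0 o * Real.cosh ‖s + Y 0 o‖) * Real.exp V := by
          rw [Finset.sum_mul]
          exact Finset.sum_congr rfl fun o _ => by ring
      _ ≤ (Real.cosh ‖s‖ * Real.exp (∑ o, w 0 o * ‖Y 0 o‖ ^ 2)) * Real.exp V := by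
          gcongr
          calc ∑ o, w 0 o * Real.cosh ‖s + Y 0 o‖
              ≤ ∑ o, (Real.cosh ‖s‖ * (w 0 o + w 0 o * ‖Y 0 o‖ ^ 2) +
                  ⟪(Real.sinh ‖s‖ / ‖s‖) • s, w 0 o • Y 0 o⟫) := by
                refine Finset.sum_le_sum fun o _ => ?_
                rw [real_inner_smul_right]
                by_cases h : w 0 o = 0
                · simp [h]
                · have := mul_le_mul_of_nonneg_left
                    (cosh_norm_add_le_of_norm_le_one s (Y 0 o) (hY 0 o h)) (hw0 0 o)
                  linarith
            _ = Real.cosh ‖s‖ * (1 + ∑ o, w 0 o * ‖Y 0 o‖ ^ 2) := by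
                rw [Finset.sum_add_distrib, ← inner_sum, hmean, inner_zero_right, add_zero,
                  ← Finset.mul_sum, Finset.sum_add_distrib, hw1]
            _ ≤ _ := by
                gcongr
                rw [add_comm]
                exact Real.add_one_le_exp _
      _ = _ := by rw [Fin.sum_univ_succ, Real.exp_add, mul_assoc]

lemma prodProb_lt_norm_sum_le (hw0 : ∀ m o, 0 ≤ w m o) (hw1 : ∀ m, ∑ o, w m o = 1)
    {Y : Fin t → ι → F} (hY : ∀ m o, w m o ≠ 0 → ‖Y m o‖ ≤ 1)
    (hmean : ∀ m, ∑ o, w m o • Y m o = 0) (b : ℝ) :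
    prodProb w {c | b < ‖∑ m, Y m (c m)‖} ≤
      2 * Real.exp (∑ m, ∑ o, w m o * ‖Y m o‖ ^ 2 - b) := by
  refine (prodProb_le_sum_mul hw0
    (h := fun c => 2 * Real.exp (-b) * Real.cosh ‖0 + ∑ m, Y m (c m)‖)
    (fun c => mul_nonneg (by positivity) (Real.cosh_pos _).le) fun c hc => ?_).trans ?_
  · rw [zero_add, Real.cosh_eq]
    have hc' : b < ‖∑ m, Y m (c m)‖ := hc
    have h1 : 1 ≤ Real.exp (-b) * Real.exp ‖∑ m, Y m (c m)‖ := by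
      rw [← Real.exp_add]
      exact Real.one_le_exp (by linarith)
    have h2 : 0 ≤ Real.exp (-b) * Real.exp (-‖∑ m, Y m (c m)‖) := by positivity
    linarith
  · have h := sum_prod_mul_cosh_norm_sum_le hw0 hw1 hY hmean 0
    rw [norm_zero, Real.cosh_zero, one_mul] at h
    calc _ = 2 * Real.exp (-b) *
          ∑ c : Fin t → ι, (∏ m, w m (c m)) * Real.cosh ‖0 + ∑ m, Y m (c m)‖ := by
          rw [Finset.mul_sum]
          exact Finset.sum_congr rfl fun c _ => by ring
      _ ≤ 2 * Real.exp (-b) * Real.exp (∑ m, ∑ o, w m o * ‖Y m o‖ ^ 2) := by gcongr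
      _ = _ := by rw [sub_eq_neg_add, Real.exp_add, mul_assoc]

lemma prodProb_lt_sum_le (hw0 : ∀ m o, 0 ≤ w m o) (hw1 : ∀ m, ∑ o, w m o = 1)
    {Y : Fin t → ι → ℝ} (hY : ∀ m o, w m o ≠ 0 → |Y m o| ≤ 1)
    (hmean : ∀ m, ∑ o, w m o * Y m o = 0) (b : ℝ) :
    prodProb w {c | b < ∑ m, Y m (c m)} ≤ Real.exp (∑ m, ∑ o, w m o * Y m o ^ 2 - b) := by
  refine (prodProb_le_sum_mul hw0
    (h := fun c => Real.exp (-b) * Real.exp (∑ m, Y m (c m)))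
    (fun c => by positivity) fun c hc => ?_).trans ?_
  · have hc' : b < ∑ m, Y m (c m) := hc
    rw [← Real.exp_add]
    exact Real.one_le_exp (by linarith)
  · calc _ = Real.exp (-b) *
          ∑ c : Fin t → ι, (∏ m, w m (c m)) * Real.exp (∑ m, Y m (c m)) := by
          rw [Finset.mul_sum]
          exact Finset.sum_congr rfl fun c _ => by ring
      _ ≤ Real.exp (-b) * Real.exp (∑ m, ∑ o, w m o * Y m o ^ 2) := by
          gcongr
          exact sum_prod_mul_exp_sum_le hw0 hw1 hY hmean
      _ = _ := by rw [sub_eq_neg_add, Real.exp_add]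

end ProductWeights

/-! ### Concentration of the score -/

section Score

variable {E : Type*} [NormedAddCommGroup E] [InnerProductSpace ℝ E]

/-- A positive definite operator admits a basis that is orthonormal for its form. Its coordinates
turn the dual norm into a Euclidean norm. -/
lemma exists_whitening [FiniteDimensional ℝ E] {H P : E →L[ℝ] E}
    (hpos : ∀ u, u ≠ 0 → 0 < ⟪H u, u⟫) (hsymm : ∀ u v, ⟪H u, v⟫ = ⟪H v, u⟫)
    (hHP : ∀ a, H (P a) = a) :
    ∃ b : Fin (Module.finrank ℝ E) → E, (∀ i, ⟪H (b i), b i⟫ = 1) ∧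
      ∀ a, ∑ i, ⟪b i, a⟫ ^ 2 = ⟪a, P a⟫ := by
  have hS : (H : E →ₗ[ℝ] E).IsSymmetric := fun u v => by
    rw [real_inner_comm]
    simpa [real_inner_comm] using hsymm u v
  let e := hS.eigenvectorBasis rfl
  let μ := hS.eigenvalues rfl
  have he : ∀ i, H (e i) = μ i • e i := fun i => hS.apply_eigenvectorBasis rfl i
  have hμ : ∀ i, 0 < μ i := fun i => by
    have h := hpos (e i) (e.orthonormal.ne_zero i)
    rwa [he, real_inner_smul_left, real_inner_self_eq_norm_sq, e.orthonormal.1 i, one_pow,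
      mul_one] at h
  have hs : ∀ i, (√(μ i))⁻¹ ^ 2 = (μ i)⁻¹ := fun i => by
    rw [inv_pow, Real.sq_sqrt (hμ i).le]
  refine ⟨fun i => (√(μ i))⁻¹ • e i, fun i => ?_, fun a => ?_⟩
  · rw [map_smul, he, real_inner_smul_left, real_inner_smul_left, real_inner_smul_right,
      real_inner_self_eq_norm_sq, e.orthonormal.1 i]
    have := hs i
    have h0 := (hμ i).ne'
    calc _ = (√(μ i))⁻¹ ^ 2 * μ i := by ring
      _ = 1 := by rw [this]; field_simp
  · have hP : ∀ i, ⟪e i, P a⟫ = (μ i)⁻¹ * ⟪e i, a⟫ := fun i => by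
      have h : ⟪e i, a⟫ = μ i * ⟪e i, P a⟫ := by
        rw [← real_inner_smul_left, ← he, hsymm, hHP, real_inner_comm]
      rw [h]
      have h0 := (hμ i).ne'
      field_simp
    rw [← e.sum_inner_mul_inner a (P a)]
    refine Finset.sum_congr rfl fun i _ => ?_
    rw [hP, real_inner_smul_left, mul_pow, hs, real_inner_comm a (e i)]
    ring

variable {ι : Type*} {t : ℕ} {O : Fin t → Finset ι} {f : Fin t → ι → E}
  {c : Fin t → ι} {lam : ℝ}

/-- The deviation of the sum of the chosen features from its expectation. -/
noncomputable def noise (O : Fin t → Finset ι) (f : Fin t → ι → E) (θ : E) (c : Fin t → ι) : E :=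
  ∑ m, (f m (c m) - softmaxMean (O m) (f m) θ)

lemma score_eq_sub_noise (θ : E) : score O f c lam θ = lam • θ - noise O f θ c := by
  rw [score, noise, sub_eq_neg_add, ← Finset.sum_neg_distrib]
  simp

variable [DecidableEq ι]

/-- The distribution of the choice in round `m`: the softmax distribution on `O m`. -/
noncomputable def choiceWeight (O : Fin t → Finset ι) (f : Fin t → ι → E) (θ : E) (m : Fin t)
    (o : ι) : ℝ :=
  if o ∈ O m then softmax (O m) (f m) θ o else 0

lemma choiceWeight_nonneg (hO : ∀ m, (O m).Nonempty) (θ : E) (m : Fin t) (o : ι) :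
    0 ≤ choiceWeight O f θ m o := by
  unfold choiceWeight
  split_ifs
  · exact (softmax_pos (hO m) θ o).le
  · exact le_rfl

lemma mem_of_choiceWeight_ne_zero {θ : E} {m : Fin t} {o : ι} (h : choiceWeight O f θ m o ≠ 0) :
    o ∈ O m := by
  by_contra ho
  exact h (if_neg ho)

variable [Fintype ι]

lemma sum_choiceWeight_smul {V : Type*} [AddCommGroup V] [Module ℝ V] (θ : E) (m : Fin t)
    (g : ι → V) :
    ∑ o, choiceWeight O f θ m o • g o = ∑ o ∈ O m, softmax (O m) (f m) θ o • g o := by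
  simp [choiceWeight, ite_smul]

lemma sum_choiceWeight (hO : ∀ m, (O m).Nonempty) (θ : E) (m : Fin t) :
    ∑ o, choiceWeight O f θ m o = 1 := by
  simpa [sum_softmax (hO m)] using sum_choiceWeight_smul (O := O) (f := f) θ m fun _ => (1 : ℝ)

lemma sum_choiceWeight_smul_sub (hO : ∀ m, (O m).Nonempty) (θ : E) (m : Fin t) :
    ∑ o, choiceWeight O f θ m o • (f m o - softmaxMean (O m) (f m) θ) = 0 := by
  rw [sum_choiceWeight_smul, sum_softmax_smul_sub (hO m)]

lemma sum_sum_choiceWeight_mul_sq_le (hlam : 0 ≤ lam) (θ u : E) :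
    ∑ m, ∑ o, choiceWeight O f θ m o * ⟪u, f m o - softmaxMean (O m) (f m) θ⟫ ^ 2 ≤
      ⟪info O f lam θ u, u⟫ := by
  rw [inner_info]
  refine le_add_of_le_of_nonneg (Finset.sum_le_sum fun m _ => le_of_eq ?_)
    (mul_nonneg hlam real_inner_self_nonneg)
  have := sum_choiceWeight_smul (O := O) (f := f) θ m
    fun o => ⟪u, f m o - softmaxMean (O m) (f m) θ⟫ ^ 2
  simp only [smul_eq_mul] at this
  rw [this, inner_softmaxCov]
  refine Finset.sum_congr rfl fun o _ => ?_
  rw [real_inner_comm, sq]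

variable [FiniteDimensional ℝ E]

/-- With probability at least `1 - δ` the noise has dual norm at most `4 √(n L)`, with `n` the
dimension, and is at most `5 √L'` times the dual norm along each of finitely many directions.

If `√L' ≤ 72 √(n L)`, the features are small enough for Bernstein's inequality at level `L'` in
every direction; otherwise the directional bounds are weaker than the bound on the norm. -/
theorem le_prodProb_noise_bounds (hO : ∀ m, (O m).Nonempty) (hlam : 0 ≤ lam) {θs : E}
    (hpos : ∀ u, u ≠ 0 → 0 < ⟪info O f lam θs u, u⟫) {P : E →L[ℝ] E}
    (hHP : ∀ a, info O f lam θs (P a) = a) {L L' δ : ℝ} (hn : 0 < Module.finrank ℝ E)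
    (hL : 0 < L) (hL' : 0 ≤ L')
    (hf : ∀ m, ∀ o ∈ O m, dualNorm P (f m o) * (144 * √(Module.finrank ℝ E * L)) ≤ 1)
    {κ : Type*} [Fintype κ] (v : κ → E)
    (hδ : 2 * Real.exp (-(3 * L)) + Fintype.card κ * (2 * Real.exp (-(4 * L'))) ≤ δ) :
    1 - δ ≤ prodProb (choiceWeight O f θs) {c | (∀ m, c m ∈ O m) ∧
      dualNorm P (noise O f θs c) ≤ 4 * √(Module.finrank ℝ E * L) ∧
      ∀ k, |⟪noise O f θs c, P (v k)⟫| ≤ 5 * √L' * dualNorm P (v k)} := by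
  set n : ℝ := (Module.finrank ℝ E : ℝ) with hn_def
  have hn1 : 1 ≤ n := by rw [hn_def]; exact_mod_cast hn
  set H := info O f lam θs with hH
  have hsymm : ∀ u v, ⟪H u, v⟫ = ⟪H v, u⟫ := inner_info_comm θs
  set w := choiceWeight O f θs with hw
  have hw0 : ∀ m o, 0 ≤ w m o := choiceWeight_nonneg hO θs
  have hw1 : ∀ m, ∑ o, w m o = 1 := sum_choiceWeight hO θs
  set ξ : Fin t → ι → E := fun m o => f m o - softmaxMean (O m) (f m) θs with hξ
  have hξmean : ∀ m, ∑ o, w m o • ξ m o = 0 := sum_choiceWeight_smul_sub hO θs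
  have hdual := abs_inner_le_dualNorm hpos hsymm hHP
  obtain ⟨b, hb, hbP⟩ := exists_whitening hpos hsymm hHP
  -- whitened coordinates
  let W : E →ₗ[ℝ] EuclideanSpace ℝ (Fin (Module.finrank ℝ E)) :=
    { toFun := fun a => WithLp.toLp 2 fun i => ⟪b i, a⟫
      map_add' := fun x y => by ext i; simp [inner_add_right]
      map_smul' := fun r x => by ext i; simp [real_inner_smul_right] }
  have hWsq : ∀ a, ‖W a‖ ^ 2 = ∑ i, ⟪b i, a⟫ ^ 2 := fun a => by
    rw [EuclideanSpace.real_norm_sq_eq]; rfl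
  have hW : ∀ a, ‖W a‖ = dualNorm P a := fun a => by
    rw [dualNorm, ← hbP, ← hWsq, Real.sqrt_sq (norm_nonneg _)]
  have hs : 0 < √(n * L) := Real.sqrt_pos.2 (by positivity)
  set R := √(n * L) with hR
  have hRsq : R ^ 2 = n * L := Real.sq_sqrt (by positivity)
  have hfM : ∀ m, ∀ o ∈ O m, ‖W (f m o)‖ ≤ 1 / (144 * R) := fun m o ho => by
    rw [hW, le_div_iff₀ (by positivity)]
    exact hf m o ho
  have hξM : ∀ m o, w m o ≠ 0 → ‖W (ξ m o)‖ ≤ 1 / (72 * R) := fun m o ho => by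
    have ho' : o ∈ O m := mem_of_choiceWeight_ne_zero ho
    have hmean : ‖W (softmaxMean (O m) (f m) θs)‖ ≤ 1 / (144 * R) := by
      rw [softmaxMean, map_sum]
      calc ‖∑ o ∈ O m, W (softmax (O m) (f m) θs o • f m o)‖
          ≤ ∑ o ∈ O m, softmax (O m) (f m) θs o * (1 / (144 * R)) := by
            refine norm_sum_le_of_le _ fun a ha => ?_
            rw [map_smul, norm_smul, Real.norm_of_nonneg (softmax_pos (hO m) θs a).le]
            exact mul_le_mul_of_nonneg_left (hfM m a ha) (softmax_pos (hO m) θs a).le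
        _ = _ := by rw [← Finset.sum_mul, sum_softmax (hO m), one_mul]
    calc ‖W (ξ m o)‖ ≤ ‖W (f m o)‖ + ‖W (softmaxMean (O m) (f m) θs)‖ := by
          rw [hξ, map_sub]; exact norm_sub_le _ _
      _ ≤ 1 / (144 * R) + 1 / (144 * R) := add_le_add (hfM m o ho') hmean
      _ = _ := by field_simp; norm_num
  have hvar : ∀ u, ∑ m, ∑ o, w m o * ⟪u, ξ m o⟫ ^ 2 ≤ ⟪H u, u⟫ :=
    sum_sum_choiceWeight_mul_sq_le hlam θs
  have hnoise : ∀ c, noise O f θs c = ∑ m, ξ m (c m) := fun c => rfl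
  -- the total variance of the whitened noise is the trace of the identity
  have htrace : ∑ m, ∑ o, w m o * ‖W (ξ m o)‖ ^ 2 ≤ n := by
    calc ∑ m, ∑ o, w m o * ‖W (ξ m o)‖ ^ 2
        = ∑ i, ∑ m, ∑ o, w m o * ⟪b i, ξ m o⟫ ^ 2 := by
          simp only [hWsq, Finset.mul_sum]
          rw [Finset.sum_comm]
          simp only [Finset.sum_comm (s := (Finset.univ : Finset (Fin (Module.finrank ℝ E))))]
          rw [Finset.sum_comm]
      _ ≤ ∑ i, ⟪H (b i), b i⟫ := Finset.sum_le_sum fun i _ => hvar (b i)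
      _ = n := by simp [hb, hn_def]
  have hB : prodProb w {c | 4 * R < dualNorm P (noise O f θs c)} ≤ 2 * Real.exp (-(3 * L)) := by
    -- `ρ = √(L / n)`, for which the exponent `ρ ^ 2 * n - ρ * (4 * √(n * L))` is `-3 * L`
    set ρ := R / n with hρ
    have hρ0 : 0 < ρ := by positivity
    have hρR : ρ * R = L := by rw [hρ, div_mul_eq_mul_div, ← sq, hRsq]; field_simp
    have hρn : ρ ^ 2 * n = L := by
      rw [hρ, div_pow, hRsq]; field_simp
    have h := prodProb_lt_norm_sum_le (w := w) (Y := fun m o => ρ • W (ξ m o)) hw0 hw1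
      (fun m o ho => by
        rw [norm_smul, Real.norm_of_nonneg hρ0.le]
        calc ρ * ‖W (ξ m o)‖ ≤ ρ * (1 / (72 * R)) := by gcongr; exact hξM m o ho
          _ = 1 / (72 * n) := by rw [hρ]; field_simp
          _ ≤ 1 := by rw [div_le_one (by positivity)]; linarith)
      (fun m => by
        have := congrArg (fun z => ρ • W z) (hξmean m)
        simp only [map_sum, map_smul, Finset.smul_sum, map_zero, smul_zero] at this
        rw [← this]
        exact Finset.sum_congr rfl fun o _ => smul_comm _ _ _) (4 * L)
    refine le_trans ?_ (h.trans ?_)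
    · refine prodProb_le_of_imp hw0 fun c _ hc => ?_
      have hc' : 4 * R < dualNorm P (noise O f θs c) := hc
      change 4 * L < ‖∑ m, ρ • W (ξ m (c m))‖
      rw [← Finset.smul_sum, ← map_sum, ← hnoise, norm_smul, Real.norm_of_nonneg hρ0.le, hW,
        ← hρR]
      nlinarith
    · gcongr
      have : ∑ m, ∑ o, w m o * ‖ρ • W (ξ m o)‖ ^ 2 =
          ρ ^ 2 * ∑ m, ∑ o, w m o * ‖W (ξ m o)‖ ^ 2 := by
        simp only [norm_smul, mul_pow, Real.norm_of_nonneg hρ0.le, Finset.mul_sum]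
        exact Finset.sum_congr rfl fun m _ => Finset.sum_congr rfl fun o _ => by ring
      rw [this]
      have := mul_le_mul_of_nonneg_left htrace (sq_nonneg ρ)
      linarith
  have hqsq : √L' ^ 2 = L' := Real.sq_sqrt hL'
  have hq0 : 0 ≤ √L' := Real.sqrt_nonneg _
  set q := √L' with hq
  -- one-sided directional bound, for directions of information norm one
  have hdir1 : ∀ p : E, √⟪H p, p⟫ = 1 → q ≤ 72 * R →
      prodProb w {c | 5 * q < ⟪noise O f θs c, p⟫} ≤ Real.exp (-(4 * L')) := by
    intro p hp hqR
    rcases hq0.eq_or_lt with hq00 | hqpos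
    · have hL0 : L' = 0 := by rw [← hqsq, ← hq00]; norm_num
      rw [hL0, mul_zero, neg_zero, Real.exp_zero, ← one_sub_prodProb_compl hw1, sub_le_self_iff]
      exact Finset.sum_nonneg fun c _ =>
        Set.indicator_nonneg (fun c _ => Finset.prod_nonneg fun m _ => hw0 m _) c
    have h := prodProb_lt_sum_le (w := w) (Y := fun m o => q * ⟪ξ m o, p⟫) hw0 hw1
      (fun m o ho => by
        rw [abs_mul, abs_of_nonneg hq0]
        have h1 := hdual (ξ m o) p
        rw [hp, mul_one, ← hW] at h1
        calc q * |⟪ξ m o, p⟫| ≤ (72 * R) * (1 / (72 * R)) :=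
              mul_le_mul hqR (h1.trans (hξM m o ho)) (abs_nonneg _) (by positivity)
          _ = 1 := by field_simp)
      (fun m => by
        have := congrArg (fun z => q * ⟪z, p⟫) (hξmean m)
        simp only [sum_inner, real_inner_smul_left, inner_zero_left, mul_zero,
          Finset.mul_sum] at this
        rw [← this]
        exact Finset.sum_congr rfl fun o _ => mul_left_comm _ _ _) (5 * L')
    refine le_trans ?_ (h.trans ?_)
    · refine prodProb_le_of_imp hw0 fun c _ hc => ?_
      have hc' : 5 * q < ⟪noise O f θs c, p⟫ := hc
      change 5 * L' < ∑ m, q * ⟪ξ m (c m), p⟫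
      rw [← Finset.mul_sum, ← sum_inner, ← hnoise, ← hqsq]
      nlinarith
    · rw [Real.exp_le_exp]
      have : ∑ m, ∑ o, w m o * (q * ⟪ξ m o, p⟫) ^ 2 =
          q ^ 2 * ∑ m, ∑ o, w m o * ⟪p, ξ m o⟫ ^ 2 := by
        simp only [mul_pow, Finset.mul_sum]
        exact Finset.sum_congr rfl fun m _ => Finset.sum_congr rfl fun o _ => by
          rw [real_inner_comm]; ring
      rw [this, hqsq]
      have h1 : ⟪H p, p⟫ = 1 := by
        rwa [Real.sqrt_eq_one] at hp
      have := mul_le_mul_of_nonneg_left ((hvar p).trans_eq h1) hL'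
      linarith
  have hdir : ∀ a : E, prodProb w ({c | ¬ |⟪noise O f θs c, P a⟫| ≤ 5 * q * dualNorm P a} \
      {c | 4 * R < dualNorm P (noise O f θs c)}) ≤ 2 * Real.exp (-(4 * L')) := by
    intro a
    have hHa : √⟪H (P a), P a⟫ = dualNorm P a := by rw [hHP, dualNorm]
    rcases le_or_gt q (72 * R) with hqR | hqR
    · rcases (dualNorm_nonneg P a).eq_or_lt with h0 | h0
      · have h : {c | ¬ |⟪noise O f θs c, P a⟫| ≤ 5 * q * dualNorm P a} = ∅ := by
          refine Set.eq_empty_of_forall_notMem fun c hc => hc ?_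
          refine (hdual _ _).trans ?_
          rw [hHa, ← h0, mul_zero, mul_zero]
        rw [h, Set.empty_sdiff, prodProb_empty]
        positivity
      set p := (dualNorm P a)⁻¹ • P a with hp
      have hPa : P a = dualNorm P a • p := by rw [hp, smul_inv_smul₀ h0.ne']
      have hp1 : √⟪H p, p⟫ = 1 := by
        rw [hp, map_smul, real_inner_smul_left, real_inner_smul_right, ← mul_assoc, ← sq,
          Real.sqrt_mul (sq_nonneg _), Real.sqrt_sq (inv_pos.2 h0).le, hHa, inv_mul_cancel₀ h0.ne']
      have hp2 : √⟪H (-p), -p⟫ = 1 := by simpa using hp1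
      calc _ ≤ prodProb w ({c | 5 * q < ⟪noise O f θs c, p⟫} ∪
            {c | 5 * q < ⟪noise O f θs c, -p⟫}) := by
            refine prodProb_le_of_imp hw0 fun c _ hc => ?_
            have hc1 := not_le.1 (show ¬ |⟪noise O f θs c, P a⟫| ≤ 5 * q * dualNorm P a from hc.1)
            rw [hPa, real_inner_smul_right, abs_mul, abs_of_pos h0, mul_comm (dualNorm P a)] at hc1
            have hc2 := lt_of_mul_lt_mul_right hc1 h0.le
            rcases lt_abs.1 hc2 with h | h
            · exact Or.inl h
            · exact Or.inr (by simpa using h)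
        _ ≤ Real.exp (-(4 * L')) + Real.exp (-(4 * L')) :=
            (prodProb_union_le hw0 _ _).trans
              (add_le_add (hdir1 p hp1 hqR) (hdir1 (-p) hp2 hqR))
        _ = _ := by ring
    · -- the bound on the norm is the stronger one, since `4 * R ≤ 5 * q`
      have h : {c | ¬ |⟪noise O f θs c, P a⟫| ≤ 5 * q * dualNorm P a} \
          {c | 4 * R < dualNorm P (noise O f θs c)} = ∅ := by
        refine Set.eq_empty_of_forall_notMem fun c hc => hc.1 ?_
        have h1 : dualNorm P (noise O f θs c) ≤ 4 * R := not_lt.1 hc.2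
        refine (hdual _ _).trans ?_
        rw [hHa]
        gcongr
        · exact dualNorm_nonneg P a
        · linarith
      rw [h, prodProb_empty]
      positivity
  -- union bound
  rw [← one_sub_prodProb_compl hw1]
  refine sub_le_sub_left (le_trans ?_ hδ) 1
  set B := {c | 4 * R < dualNorm P (noise O f θs c)} with hBdef
  calc _ ≤ prodProb w (B ∪ ⋃ k ∈ (Finset.univ : Finset κ),
        {c | ¬ |⟪noise O f θs c, P (v k)⟫| ≤ 5 * q * dualNorm P (v k)} \ B) := by
        refine prodProb_le_of_imp hw0 fun c hcw hc => ?_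
        by_cases hcB : c ∈ B
        · exact Or.inl hcB
        refine Or.inr ?_
        by_contra hcon
        simp only [Finset.mem_univ, Set.iUnion_true, Set.mem_iUnion, not_exists] at hcon
        refine hc ⟨fun m => mem_of_choiceWeight_ne_zero (hcw m), not_lt.1 hcB, fun k => ?_⟩
        by_contra hk
        exact hcon k ⟨hk, hcB⟩
    _ ≤ 2 * Real.exp (-(3 * L)) + ∑ k : κ, 2 * Real.exp (-(4 * L')) :=
        (prodProb_union_le hw0 _ _).trans (add_le_add hB
          ((prodProb_iUnion_le hw0 _ _).trans (Finset.sum_le_sum fun k _ => hdir (v k))))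
    _ = _ := by simp

end Score

/-! ### The pricing model as a softmax model -/

section Matrix

variable {τ ι κ : Type*} [Fintype τ] [Fintype κ] [DecidableEq κ]

/-- The matrix of the information operator in the standard basis. -/
noncomputable def infoMatrix (O : τ → Finset ι) (f : τ → ι → EuclideanSpace ℝ κ) (lam : ℝ)
    (θ : EuclideanSpace ℝ κ) : Matrix κ κ ℝ :=
  Matrix.of fun k l =>
    ⟪info O f lam θ (EuclideanSpace.single k 1), EuclideanSpace.single l 1⟫

variable {O : τ → Finset ι} {f : τ → ι → EuclideanSpace ℝ κ} {lam : ℝ} {θ : EuclideanSpace ℝ κ}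

lemma toEuclideanCLM_infoMatrix :
    Matrix.toEuclideanCLM (𝕜 := ℝ) (infoMatrix O f lam θ) = info O f lam θ := by
  ext u i
  have h : ⟪info O f lam θ u, EuclideanSpace.single i 1⟫ = (info O f lam θ u) i := by
    simp [EuclideanSpace.inner_single_right]
  rw [Matrix.ofLp_toEuclideanCLM, ← h, inner_info_comm]
  have hu : u = ∑ l, u l • EuclideanSpace.single l (1 : ℝ) := by
    ext j
    simp [Pi.single_apply]
  conv_rhs => rw [hu, inner_sum]
  simp only [Matrix.mulVec, dotProduct, infoMatrix, Matrix.of_apply, real_inner_smul_right]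
  exact Finset.sum_congr rfl fun l _ => mul_comm _ _

lemma isHermitian_infoMatrix : (infoMatrix O f lam θ).IsHermitian := by
  ext k l
  simp only [Matrix.conjTranspose_apply, infoMatrix, Matrix.of_apply, star_trivial]
  exact inner_info_comm _ _ _

lemma dotProduct_infoMatrix_mulVec (x : κ → ℝ) :
    dotProduct x ((infoMatrix O f lam θ).mulVec x) =
      ⟪info O f lam θ (WithLp.toLp 2 x), WithLp.toLp 2 x⟫ := by
  rw [real_inner_comm, ← toEuclideanCLM_infoMatrix, Matrix.inner_toEuclideanCLM]

lemma inner_info_pos_of_isUnit_det (hO : ∀ m, (O m).Nonempty) (hlam : 0 ≤ lam)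
    (hdet : IsUnit (infoMatrix O f lam θ).det) (u : EuclideanSpace ℝ κ) (hu : u ≠ 0) :
    0 < ⟪info O f lam θ u, u⟫ := by
  have hpsd : (infoMatrix O f lam θ).PosSemidef := by
    refine .of_dotProduct_mulVec_nonneg isHermitian_infoMatrix fun x => ?_
    rw [star_trivial, dotProduct_infoMatrix_mulVec]
    exact (mul_nonneg hlam (sq_nonneg _)).trans (lam_mul_le_inner_info hO θ _)
  have hpd := hpsd.posDef_iff_isUnit.2 ((Matrix.isUnit_iff_isUnit_det _).2 hdet)
  have h := hpd.dotProduct_mulVec_pos (x := u.ofLp) (by simpa using hu)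
  rwa [star_trivial, dotProduct_infoMatrix_mulVec] at h

lemma info_toEuclideanCLM_inv (hdet : IsUnit (infoMatrix O f lam θ).det)
    (a : EuclideanSpace ℝ κ) :
    info O f lam θ (Matrix.toEuclideanCLM (𝕜 := ℝ) (infoMatrix O f lam θ)⁻¹ a) = a := by
  rw [← toEuclideanCLM_infoMatrix, ← mul_apply_eq_comp, ← map_mul,
    Matrix.mul_nonsing_inv _ hdet, map_one, one_apply_eq_self]

end Matrix

lemma weightedNorm_eq_dualNorm {d : ℕ} (A : Matrix (Fin d ⊕ Fin d) (Fin d ⊕ Fin d) ℝ)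
    (x : Param d) : weightedNorm A x = dualNorm (Matrix.toEuclideanCLM (𝕜 := ℝ) A) x := by
  rw [weightedNorm, dualNorm, Matrix.inner_toEuclideanCLM]

section Pricing

variable {N d t : ℕ}

/-- The options of a round: the offered items and the no-purchase option. -/
def optionSet (D : PricingData N d t) (m : Fin t) : Finset (Option (Fin N)) :=
  Finset.insertNone (D.assortment m)

/-- The feature of an option, which is zero for the no-purchase option. -/
def optionFeature (D : PricingData N d t) (m : Fin t) (o : Option (Fin N)) : Param d :=
  o.elim 0 (D.pricedFeature m)

lemma optionSet_nonempty (D : PricingData N d t) (m : Fin t) : (optionSet D m).Nonempty :=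
  ⟨none, by simp [optionSet]⟩

lemma prob_eq_softmax (D : PricingData N d t) (θ : Param d) (m : Fin t) (o : Option (Fin N)) :
    D.prob θ m o = softmax (optionSet D m) (optionFeature D m) θ o := by
  have h : partitionSum (optionSet D m) (optionFeature D m) θ =
      1 + ∑ j ∈ D.assortment m, Real.exp ⟪D.pricedFeature m j, θ⟫ := by
    simp [partitionSum, optionSet, optionFeature, Finset.sum_insertNone]
  rw [softmax, h]
  cases o <;> simp [PricingData.prob, choiceProb, optionFeature]

lemma loss_eq_nll {D : PricingData N d t} (hD : ∀ m, D.choice m ∈ optionSet D m) (lam : ℝ) :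
    D.loss lam = nll (optionSet D) (optionFeature D) D.choice lam := by
  funext θ
  rw [PricingData.loss, nll, ← Finset.sum_neg_distrib]
  congr 1
  refine Finset.sum_congr rfl fun m _ => ?_
  have : ∀ o, (if D.choice m = o then (1 : ℝ) else 0) * Real.log (D.prob θ m o) =
      if D.choice m = o then Real.log (D.prob θ m o) else 0 := fun o => by
    split_ifs <;> simp
  simp only [this]
  have hm : D.choice m ∈ Finset.insertNone (D.assortment m) := hD m
  rw [Finset.sum_ite_eq, if_pos hm, prob_eq_softmax, softmax_eq_exp (optionSet_nonempty D m),
    Real.log_exp]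
  ring

lemma hessian_eq_infoMatrix {D : PricingData N d t} (hD : ∀ m, D.choice m ∈ optionSet D m)
    (lam : ℝ) (θ : Param d) :
    D.hessian lam θ = infoMatrix (optionSet D) (optionFeature D) lam θ := by
  ext k l
  rw [PricingData.hessian, infoMatrix, Matrix.of_apply, Matrix.of_apply, loss_eq_nll hD]
  have h1 : (fun η => fderiv ℝ (nll (optionSet D) (optionFeature D) D.choice lam) η
      (EuclideanSpace.single l 1)) =
      fun η => ⟪score (optionSet D) (optionFeature D) D.choice lam η,
        EuclideanSpace.single l (1 : ℝ)⟫ := by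
    funext η
    rw [(hasFDerivAt_nll (optionSet_nonempty D) η).fderiv]
    rfl
  have h2 := (hasFDerivAt_score (f := optionFeature D) (c := D.choice) (lam := lam)
    (optionSet_nonempty D) θ).inner ℝ
    (hasFDerivAt_const (EuclideanSpace.single l (1 : ℝ)) θ)
  rw [h1, h2.fderiv]
  simp

end Pricing

/-! ### Measurability of the concentration event -/

section Measurability

variable {Ω : Type*} [MeasurableSpace Ω]

lemma measurable_det {κ : Type*} [Fintype κ] [DecidableEq κ] {M : Ω → Matrix κ κ ℝ}
    (hM : ∀ i j, Measurable fun ω => M ω i j) : Measurable fun ω => (M ω).det := by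
  simp only [Matrix.det_apply']
  exact Finset.measurable_sum _ fun σ _ =>
    (Finset.measurable_prod _ fun i _ => hM _ _).const_mul _

lemma measurable_inv_apply {κ : Type*} [Fintype κ] [DecidableEq κ] {M : Ω → Matrix κ κ ℝ}
    (hM : ∀ i j, Measurable fun ω => M ω i j) (i j : κ) :
    Measurable fun ω => (M ω)⁻¹ i j := by
  simp only [Matrix.inv_def, Ring.inverse_eq_inv', Matrix.smul_apply, Matrix.adjugate_apply,
    smul_eq_mul]
  refine (measurable_det hM).inv.mul (measurable_det fun k l => ?_)
  simp only [Matrix.updateRow_apply]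
  split_ifs
  · exact measurable_const
  · exact hM k l

variable {ι κ κ' : Type*} [Fintype κ] [DecidableEq κ] {t : ℕ}

/-- The choices for which the noise is at most `a` in the dual norm and at most `b` times the dual
norm along each of the directions `v k`. If the information matrix is singular its inverse is zero
and the bounds say nothing; the burn-in condition excludes this case. -/
def goodChoices (O : Fin t → Finset ι) (f : Fin t → ι → EuclideanSpace ℝ κ) (lam : ℝ)
    (θ : EuclideanSpace ℝ κ) (v : κ' → EuclideanSpace ℝ κ) (a b : ℝ) : Set (Fin t → ι) :=
  {c | (∀ m, c m ∈ O m) ∧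
    dualNorm (Matrix.toEuclideanCLM (𝕜 := ℝ) (infoMatrix O f lam θ)⁻¹) (noise O f θ c) ≤ a ∧
    ∀ k, |⟪noise O f θ c, Matrix.toEuclideanCLM (𝕜 := ℝ) (infoMatrix O f lam θ)⁻¹ (v k)⟫| ≤
      b * dualNorm (Matrix.toEuclideanCLM (𝕜 := ℝ) (infoMatrix O f lam θ)⁻¹) (v k)}

lemma mem_goodChoices {O : Fin t → Finset ι} {f : Fin t → ι → EuclideanSpace ℝ κ} {lam : ℝ}
    {θ : EuclideanSpace ℝ κ} {v : κ' → EuclideanSpace ℝ κ} {a b : ℝ} {c : Fin t → ι} :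
    c ∈ goodChoices O f lam θ v a b ↔ (∀ m, c m ∈ O m) ∧
      dualNorm (Matrix.toEuclideanCLM (𝕜 := ℝ) (infoMatrix O f lam θ)⁻¹) (noise O f θ c) ≤ a ∧
      ∀ k, |⟪noise O f θ c, Matrix.toEuclideanCLM (𝕜 := ℝ) (infoMatrix O f lam θ)⁻¹ (v k)⟫| ≤
        b * dualNorm (Matrix.toEuclideanCLM (𝕜 := ℝ) (infoMatrix O f lam θ)⁻¹) (v k) :=
  Iff.rfl

lemma measurableSet_mem_goodChoices [Countable κ'] (O : Fin t → Finset ι)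
    {f : Ω → Fin t → ι → EuclideanSpace ℝ κ} (hf : ∀ m o, Measurable fun ω => f ω m o)
    {v : Ω → κ' → EuclideanSpace ℝ κ} (hv : ∀ k, Measurable fun ω => v ω k) (lam : ℝ)
    (θ : EuclideanSpace ℝ κ) (a b : ℝ) (c : Fin t → ι) :
    MeasurableSet {ω | c ∈ goodChoices O (f ω) lam θ (v ω) a b} := by
  have hZ : ∀ m, Measurable fun ω => partitionSum (O m) (f ω m) θ := fun m =>
    Finset.measurable_sum _ fun o _ => ((hf m o).inner_const).exp
  have hp : ∀ m o, Measurable fun ω => softmax (O m) (f ω m) θ o := fun m o =>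
    ((hf m o).inner_const).exp.div (hZ m)
  have hmean : ∀ m, Measurable fun ω => softmaxMean (O m) (f ω m) θ := fun m =>
    Finset.measurable_sum _ fun o _ => (hp m o).smul (hf m o)
  have hnoise : Measurable fun ω => noise O (f ω) θ c :=
    Finset.measurable_sum _ fun m _ => (hf m (c m)).sub (hmean m)
  have hM : ∀ k l, Measurable fun ω => infoMatrix O (f ω) lam θ k l := by
    intro k l
    simp only [infoMatrix, Matrix.of_apply, inner_info, inner_softmaxCov]
    refine (Finset.measurable_sum _ fun m _ => Finset.measurable_sum _ fun o _ =>
      (hp m o).mul (Measurable.mul ?_ ?_)).add_const _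
    · exact ((hf m o).sub (hmean m)).inner_const
    · exact ((hf m o).sub (hmean m)).inner_const
  have hform : ∀ {x y : Ω → EuclideanSpace ℝ κ}, Measurable x → Measurable y →
      Measurable fun ω =>
        ⟪x ω, Matrix.toEuclideanCLM (𝕜 := ℝ) (infoMatrix O (f ω) lam θ)⁻¹ (y ω)⟫ := by
    intro x y hx hy
    have hcoord : ∀ {x : Ω → EuclideanSpace ℝ κ}, Measurable x → ∀ i, Measurable fun ω => x ω i :=
      fun hx i => (EuclideanSpace.proj (𝕜 := ℝ) i).continuous.measurable.comp hx
    simp only [Matrix.inner_toEuclideanCLM, dotProduct, Matrix.mulVec]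
    exact Finset.measurable_sum _ fun i _ => (hcoord hx i).mul
      (Finset.measurable_sum _ fun j _ => (measurable_inv_apply hM i j).mul (hcoord hy j))
  simp only [mem_goodChoices, Set.ofPred_and, Set.ofPred_forall]
  refine (MeasurableSet.iInter fun m : Fin t => MeasurableSet.const (c m ∈ O m)).inter
    (MeasurableSet.inter ?_ ?_)
  · exact measurableSet_le (hform hnoise hnoise).sqrt measurable_const
  · exact MeasurableSet.iInter fun k => measurableSet_le (measurable_abs.comp (hform hnoise (hv k)))
      ((hform (hv k) (hv k)).sqrt.const_mul b)

end Measurability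

/-! ### Conditional probabilities given the designs -/

section Conditional

variable {Ω : Type*} {N d t : ℕ}

lemma measurable_pricedFeature_designSigma (D : Ω → PricingData N d t) (m : Fin t) (j : Fin N) :
    Measurable[designSigma D] fun ω => (D ω).pricedFeature m j := by
  have h : Measurable[designSigma D] fun ω => (D ω).pricedFeature m := by
    refine Measurable.mono (comap_measurable _) ?_ le_rfl
    exact le_sup_left.trans (le_iSup (fun m => MeasurableSpace.comap
      (fun ω => (D ω).pricedFeature m) inferInstance ⊔
      MeasurableSpace.comap (fun ω => (D ω).assortment m) ⊤) m)
  exact (measurable_pi_apply j).comp h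

lemma measurableSet_assortment_designSigma (D : Ω → PricingData N d t) (m : Fin t)
    (B : Set (Finset (Fin N))) :
    MeasurableSet[designSigma D] {ω | (D ω).assortment m ∈ B} := by
  have h : MeasurableSpace.comap (fun ω => (D ω).assortment m) ⊤ ≤ designSigma D :=
    le_sup_right.trans (le_iSup (fun m => MeasurableSpace.comap
      (fun ω => (D ω).pricedFeature m) inferInstance ⊔
      MeasurableSpace.comap (fun ω => (D ω).assortment m) ⊤) m)
  exact h _ ⟨B, trivial, rfl⟩

lemma designSigma_le [MeasurableSpace Ω] {D : Ω → PricingData N d t} (hD : MeasurableData D) :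
    designSigma D ≤ ‹MeasurableSpace Ω› := by
  refine iSup_le fun m => sup_le ?_ ?_
  · refine Measurable.comap_le (measurable_pi_lambda _ fun j => ?_)
    refine (WithLp.measurable_toLp 2 _).comp (measurable_pi_lambda _ fun k => ?_)
    have hcoord : ∀ k, Measurable fun ω => (D ω).feature m j k := fun k =>
      (EuclideanSpace.proj (𝕜 := ℝ) k).continuous.measurable.comp (hD.feature m j)
    rcases k with k | k
    · exact hcoord k
    · exact (hD.price m j).neg.mul (hcoord k)
  · rintro _ ⟨B, -, rfl⟩
    have h : (fun ω => (D ω).assortment m) ⁻¹' B =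
        ⋃ S ∈ B, {ω | (D ω).assortment m = S} := by
      ext ω; simp
    rw [h]
    exact MeasurableSet.biUnion (Set.to_countable B) fun S _ => hD.assortment m S

lemma measurableSet_mem_optionSet_designSigma (D : Ω → PricingData N d t)
    (c : Fin t → Option (Fin N)) :
    MeasurableSet[designSigma D] {ω | ∀ m, c m ∈ optionSet (D ω) m} := by
  rw [Set.ofPred_forall]
  exact @MeasurableSet.iInter _ _ (designSigma D) _ _ fun m =>
    measurableSet_assortment_designSigma D m {S | c m ∈ Finset.insertNone S}

/-- The directions along which the noise has to be controlled: `x` itself and all priced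
features. -/
def directions (D : PricingData N d t) (x : Param d) : Option (Fin t × Fin N) → Param d :=
  fun k => k.elim x fun mj => D.pricedFeature mj.1 mj.2

lemma measurableSet_mem_goodChoices_designSigma (D : Ω → PricingData N d t) (lam : ℝ)
    (θ x : Param d) (a b : ℝ) (c : Fin t → Option (Fin N)) :
    MeasurableSet[designSigma D] {ω | c ∈ goodChoices (optionSet (D ω)) (optionFeature (D ω))
      lam θ (directions (D ω) x) a b} := by
  let _ : MeasurableSpace Ω := designSigma D
  have h : {ω | c ∈ goodChoices (optionSet (D ω)) (optionFeature (D ω))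
        lam θ (directions (D ω) x) a b} =
      ⋃ S : Fin t → Finset (Fin N), (⋂ m, {ω | (D ω).assortment m ∈ ({S m} : Set _)}) ∩
        {ω | c ∈ goodChoices (fun m => Finset.insertNone (S m)) (optionFeature (D ω))
          lam θ (directions (D ω) x) a b} := by
    ext ω
    simp only [Set.mem_iUnion, Set.mem_inter_iff, Set.mem_iInter, Set.mem_ofPred_eq,
      Set.mem_singleton_iff]
    constructor
    · exact fun h => ⟨(D ω).assortment, fun _ => rfl, h⟩
    · rintro ⟨S, hS, h⟩
      obtain rfl : (D ω).assortment = S := funext hS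
      exact h
  rw [h]
  refine MeasurableSet.iUnion fun S => (MeasurableSet.iInter fun m =>
    measurableSet_assortment_designSigma D m _).inter
    (measurableSet_mem_goodChoices _ (fun m o => ?_) (fun k => ?_) lam θ a b c)
  · cases o with
    | none => exact measurable_const
    | some j => exact measurable_pricedFeature_designSigma D m j
  · cases k with
    | none => exact measurable_const
    | some mj => exact measurable_pricedFeature_designSigma D mj.1 mj.2

variable [MeasurableSpace Ω] {μ : Measure Ω}
  {D : Ω → PricingData N d t} {θ : Param d}

lemma measurableSet_choice_eq (hD : MeasurableData D) (c : Fin t → Option (Fin N)) :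
    MeasurableSet {ω | (D ω).choice = c} := by
  simp only [funext_iff, Set.ofPred_forall]
  exact MeasurableSet.iInter fun m => hD.choice m (c m)

lemma condProb_choice_eq (hindep : CondIndepChoices μ D) (hmnl : MNLChoices μ D θ)
    (c : Fin t → Option (Fin N)) :
    μ⟦{ω | (D ω).choice = c} | designSigma D⟧ =ᵐ[μ]
      fun ω => ∏ m, choiceWeight (optionSet (D ω)) (optionFeature (D ω)) θ m (c m) := by
  have h := hindep fun m => {c m}
  simp only [Set.mem_singleton_iff, ← Set.ofPred_forall, ← funext_iff] at h
  have h2 : ∀ᵐ ω ∂μ, ∀ m, (μ⟦{ω | (D ω).choice m = c m} | designSigma D⟧) ω =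
      if c m ∈ Finset.insertNone ((D ω).assortment m) then (D ω).prob θ m (c m) else 0 :=
    ae_all_iff.2 fun m => hmnl m (c m)
  filter_upwards [h, h2] with ω h1 h2
  rw [h1]
  refine Finset.prod_congr rfl fun m _ => ?_
  rw [h2, choiceWeight, prob_eq_softmax]
  rfl

variable [IsProbabilityMeasure μ]

/-- The conditional probability that the vector of choices lies in a set determined by the design
is the probability of that set under the product of the softmax distributions. -/
lemma condProb_choice_mem (hD : MeasurableData D) (hindep : CondIndepChoices μ D)
    (hmnl : MNLChoices μ D θ) {A : Ω → Set (Fin t → Option (Fin N))}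
    (hA : ∀ c, MeasurableSet[designSigma D] {ω | c ∈ A ω}) :
    MeasurableSet {ω | (D ω).choice ∈ A ω} ∧
    μ⟦{ω | (D ω).choice ∈ A ω} | designSigma D⟧ =ᵐ[μ] fun ω =>
      prodProb (choiceWeight (optionSet (D ω)) (optionFeature (D ω)) θ) (A ω) := by
  have hle := designSigma_le hD
  have hcm := measurableSet_choice_eq hD
  constructor
  · have h : {ω | (D ω).choice ∈ A ω} =
        ⋃ c, {ω | c ∈ A ω} ∩ {ω | (D ω).choice = c} := by
      ext ω; simp
    rw [h]
    exact MeasurableSet.iUnion fun c => (hle _ (hA c)).inter (hcm c)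
  have hint : ∀ c, Integrable ({ω | (D ω).choice = c}.indicator fun _ => (1 : ℝ)) μ := fun c =>
    (integrable_const (1 : ℝ)).indicator (hcm c)
  have h : ({ω | (D ω).choice ∈ A ω}.indicator fun _ => (1 : ℝ)) =
      ∑ c, {ω | c ∈ A ω}.indicator ({ω | (D ω).choice = c}.indicator fun _ => (1 : ℝ)) := by
    funext ω
    rw [Finset.sum_apply, Finset.sum_eq_single (D ω).choice]
    · simp [Set.indicator]
    · intro c _ hc
      simp [Set.indicator, hc.symm]
    · simp
  rw [h]
  refine (condExp_finsetSum (fun c _ => (hint c).indicator (hle _ (hA c))) _).trans ?_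
  have h1 : ∀ᵐ ω ∂μ, ∀ c : Fin t → Option (Fin N),
      (μ[{ω | c ∈ A ω}.indicator ({ω | (D ω).choice = c}.indicator fun _ => (1 : ℝ)) |
        designSigma D]) ω =
      {ω | c ∈ A ω}.indicator (μ⟦{ω | (D ω).choice = c} | designSigma D⟧) ω :=
    ae_all_iff.2 fun c => condExp_indicator (hint c) (hA c)
  have h2 : ∀ᵐ ω ∂μ, ∀ c : Fin t → Option (Fin N),
      (μ⟦{ω | (D ω).choice = c} | designSigma D⟧) ω =
      ∏ m, choiceWeight (optionSet (D ω)) (optionFeature (D ω)) θ m (c m) :=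
    ae_all_iff.2 fun c => condProb_choice_eq hindep hmnl c
  filter_upwards [h1, h2] with ω h1 h2
  rw [Finset.sum_apply, prodProb]
  refine Finset.sum_congr rfl fun c _ => ?_
  rw [h1]
  by_cases hc : c ∈ A ω
  · rw [Set.indicator_of_mem (show ω ∈ {ω | c ∈ A ω} from hc), Set.indicator_of_mem hc, h2]
  · rw [Set.indicator_of_notMem (show ω ∉ {ω | c ∈ A ω} from hc), Set.indicator_of_notMem hc]

/-- Almost surely all choices are made from the choice sets. Off this event the loss omits terms
and its Hessian is not the information operator. -/
lemma ae_choice_mem_optionSet (hD : MeasurableData D) (hindep : CondIndepChoices μ D)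
    (hmnl : MNLChoices μ D θ) : ∀ᵐ ω ∂μ, ∀ m, (D ω).choice m ∈ optionSet (D ω) m := by
  obtain ⟨hmeas, hcond⟩ := condProb_choice_mem hD hindep hmnl
    (A := fun ω => {c | ∀ m, c m ∈ optionSet (D ω) m})
    (measurableSet_mem_optionSet_designSigma D)
  set V := {ω | (D ω).choice ∈ {c : Fin t → Option (Fin N) | ∀ m, c m ∈ optionSet (D ω) m}}
    with hV
  -- the product distribution charges only choices from the choice sets
  have hone : μ⟦V | designSigma D⟧ =ᵐ[μ] fun _ => (1 : ℝ) := by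
    filter_upwards [hcond] with ω h
    rw [h]
    have hw0 := choiceWeight_nonneg (f := optionFeature (D ω)) (optionSet_nonempty (D ω)) θ
    have hw1 := sum_choiceWeight (f := optionFeature (D ω)) (optionSet_nonempty (D ω)) θ
    have h0 : prodProb (choiceWeight (optionSet (D ω)) (optionFeature (D ω)) θ)
        {c | ∀ m, c m ∈ optionSet (D ω) m}ᶜ ≤ 0 := by
      rw [← prodProb_empty (w := choiceWeight (optionSet (D ω)) (optionFeature (D ω)) θ)]
      exact prodProb_le_of_imp hw0 fun c hc hc' =>
        hc' fun m => mem_of_choiceWeight_ne_zero (hc m)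
    have h0' : 0 ≤ prodProb (choiceWeight (optionSet (D ω)) (optionFeature (D ω)) θ)
        {c | ∀ m, c m ∈ optionSet (D ω) m}ᶜ :=
      Finset.sum_nonneg fun c _ =>
        Set.indicator_nonneg (fun c _ => Finset.prod_nonneg fun m _ => hw0 m _) c
    rw [← one_sub_prodProb_compl hw1, le_antisymm h0 h0', sub_zero]
  have h1 : μ.real V = 1 := by
    have h := integral_condExp (μ := μ) (f := V.indicator fun _ => (1 : ℝ)) (designSigma_le hD)
    rw [integral_congr_ae hone, integral_indicator_const _ hmeas] at h
    simpa using h.symm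
  have h2 : μ V = 1 := by
    rw [← ENNReal.ofReal_toReal (measure_ne_top μ V), ← Measure.real, h1, ENNReal.ofReal_one]
  exact (prob_compl_eq_zero_iff hmeas).2 h2

end Conditional

/-! ### The confidence region -/

section Confidence

variable {E : Type*} [NormedAddCommGroup E] [InnerProductSpace ℝ E] {H P : E →L[ℝ] E}

lemma abs_inner_apply_le_dualNorm (hpos : ∀ u, u ≠ 0 → 0 < ⟪H u, u⟫)
    (hsymm : ∀ u v, ⟪H u, v⟫ = ⟪H v, u⟫) (hHP : ∀ a, H (P a) = a) (a b : E) :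
    |⟪a, P b⟫| ≤ dualNorm P a * dualNorm P b := by
  have := abs_inner_le_dualNorm hpos hsymm hHP a (P b)
  rwa [hHP] at this

lemma dualNorm_sub_le (hpos : ∀ u, u ≠ 0 → 0 < ⟪H u, u⟫)
    (hsymm : ∀ u v, ⟪H u, v⟫ = ⟪H v, u⟫) (hHP : ∀ a, H (P a) = a) (a b : E) :
    dualNorm P (a - b) ≤ dualNorm P a + dualNorm P b := by
  have h1 := abs_inner_apply_le_dualNorm hpos hsymm hHP a (a - b)
  have h2 := abs_inner_apply_le_dualNorm hpos hsymm hHP b (a - b)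
  rcases (dualNorm_nonneg P (a - b)).eq_or_lt with h0 | h0
  · rw [← h0]
    exact add_nonneg (dualNorm_nonneg P a) (dualNorm_nonneg P b)
  have h3 : dualNorm P (a - b) ^ 2 = ⟪a - b, P (a - b)⟫ :=
    Real.sq_sqrt (Real.sqrt_pos.1 h0).le
  rw [inner_sub_left] at h3
  refine le_of_mul_le_mul_right ?_ h0
  linarith [le_abs_self ⟪a, P (a - b)⟫, neg_abs_le ⟪b, P (a - b)⟫]

/-- The regularization bias is at most `√lam ‖θ‖` in the dual norm, because `H ≥ lam`. -/
lemma dualNorm_smul_le {lam : ℝ} (hlam : 0 ≤ lam) (hH : ∀ u, lam * ‖u‖ ^ 2 ≤ ⟪H u, u⟫)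
    (hHP : ∀ a, H (P a) = a) (θ : E) : dualNorm P (lam • θ) ≤ √lam * ‖θ‖ := by
  have h1 := hH (P θ)
  rw [hHP] at h1
  have h2 := real_inner_le_norm θ (P θ)
  have h0 : 0 ≤ ⟪θ, P θ⟫ := (mul_nonneg hlam (sq_nonneg _)).trans h1
  have h3 : lam * ⟪θ, P θ⟫ ≤ ‖θ‖ ^ 2 := by
    rcases h0.eq_or_lt with hz | hz
    · rw [← hz, mul_zero]; positivity
    refine le_of_mul_le_mul_right ?_ hz
    calc lam * ⟪θ, P θ⟫ * ⟪θ, P θ⟫ ≤ lam * (‖θ‖ * ‖P θ‖) * (‖θ‖ * ‖P θ‖) := by gcongr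
      _ = ‖θ‖ ^ 2 * (lam * ‖P θ‖ ^ 2) := by ring
      _ ≤ _ := by gcongr
  rw [dualNorm, map_smul, real_inner_smul_left, real_inner_smul_right]
  refine Real.sqrt_le_iff.2 ⟨by positivity, ?_⟩
  rw [mul_pow, Real.sq_sqrt hlam]
  gcongr

variable {N d t : ℕ} {D : PricingData N d t} {lam W δ : ℝ} {θs : Param d}

/-- If the choices satisfy the noise bounds and the design satisfies the burn-in condition, the
estimator exists and has the claimed accuracy. -/
theorem exists_estimator_of_mem_goodChoices (hd : 0 < d) (hlam : 0 ≤ lam) (hW : 0 < W)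
    (hθ : ‖θs‖ ≤ W) (hL : 0 < Real.log (N / δ)) (hburn : BurnIn D lam W δ θs) (x : Param d)
    {q : ℝ} (hq : 0 ≤ q)
    (hgood : D.choice ∈ goodChoices (optionSet D) (optionFeature D) lam θs (directions D x)
      (4 * √(2 * d * Real.log (N / δ))) (5 * q)) :
    ∃ θhat : Param d, D.IsMLE lam θhat ∧ (∀ η, D.IsMLE lam η → η = θhat) ∧
      (D.hessian lam θhat - (1 / 3 : ℝ) • D.hessian lam θs).PosSemidef ∧
      ((3 : ℝ) • D.hessian lam θs - D.hessian lam θhat).PosSemidef ∧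
      |inner ℝ x (θhat - θs)| ≤
        16 * weightedNorm (D.hessian lam θs)⁻¹ x * (q + √lam * W) := by
  obtain ⟨hvalid, hnoise, hdir⟩ := hgood
  obtain ⟨hdet, hfeat⟩ := hburn
  simp only [hessian_eq_infoMatrix hvalid, weightedNorm_eq_dualNorm] at hdet hfeat ⊢
  have hO := optionSet_nonempty D
  have hpos := inner_info_pos_of_isUnit_det hO hlam hdet
  have hHP := info_toEuclideanCLM_inv hdet
  set P := Matrix.toEuclideanCLM (𝕜 := ℝ)
    (infoMatrix (optionSet D) (optionFeature D) lam θs)⁻¹ with hP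
  have hsymm := inner_info_comm (O := optionSet D) (f := optionFeature D) (lam := lam) θs
  have hCS := abs_inner_apply_le_dualNorm hpos hsymm hHP
  have hR : 0 < √(2 * d * Real.log (N / δ)) := by
    have : (0 : ℝ) < d := by exact_mod_cast hd
    positivity
  set R := √(2 * d * Real.log (N / δ))
  have hbias : dualNorm P (lam • θs) ≤ √lam * W :=
    (dualNorm_smul_le hlam (lam_mul_le_inner_info hO θs) hHP θs).trans (by gcongr)
  have hscore_inner : ∀ a, |⟪noise (optionSet D) (optionFeature D) θs D.choice, P a⟫| ≤
      5 * q * dualNorm P a →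
      |⟪score (optionSet D) (optionFeature D) D.choice lam θs, P a⟫| ≤
        dualNorm P a * (5 * q + √lam * W) := by
    intro a ha
    rw [score_eq_sub_noise, inner_sub_left]
    refine (abs_sub _ _).trans ?_
    have := (hCS (lam • θs) a).trans
      (mul_le_mul_of_nonneg_right hbias (dualNorm_nonneg P a))
    linarith
  obtain ⟨θh, hmin, hlow, hup, hest⟩ := exists_minimizer_of_score_bounds
    (c := D.choice) hO hlam hpos hHP
    (r := 4 * R + √lam * W) (A := 5 * q + √lam * W) (by positivity) (by positivity)
    (by
      rw [score_eq_sub_noise]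
      refine (dualNorm_sub_le hpos hsymm hHP _ _).trans ?_
      linarith)
    (fun m o ho => by
      cases o with
      | none =>
        simp only [optionFeature, Option.elim, dualNorm, inner_zero_left, Real.sqrt_zero, zero_mul]
        norm_num
      | some j =>
        have h := hfeat m j (by simpa [optionSet] using ho)
        change dualNorm P (D.pricedFeature m j) * _ ≤ _
        -- `5 / 72 = 4 / 144 + 1 / 24`
        linarith [h.1, h.2])
    (fun m o ho => by
      cases o with
      | none => simp [optionFeature, dualNorm]
      | some j => exact hscore_inner _ (hdir (some (m, j))))
  refine ⟨θh, fun η => ?_, fun η hη => ?_, ?_, ?_, ?_⟩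
  · rw [loss_eq_nll hvalid]
    rcases eq_or_ne η θh with rfl | h
    · exact le_rfl
    · exact (hmin η h).le
  · by_contra h
    have h1 := hη θh
    rw [loss_eq_nll hvalid] at h1
    exact absurd (hmin η h) (not_lt.2 h1)
  · refine .of_dotProduct_mulVec_nonneg (isHermitian_infoMatrix.sub
      (isHermitian_infoMatrix.smul (IsSelfAdjoint.all _))) fun y => ?_
    rw [star_trivial, Matrix.sub_mulVec, Matrix.smul_mulVec, dotProduct_sub, dotProduct_smul,
      dotProduct_infoMatrix_mulVec, dotProduct_infoMatrix_mulVec, smul_eq_mul]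
    linarith [hlow (WithLp.toLp 2 y)]
  · refine .of_dotProduct_mulVec_nonneg ((isHermitian_infoMatrix.smul (IsSelfAdjoint.all _)).sub
      isHermitian_infoMatrix) fun y => ?_
    rw [star_trivial, Matrix.sub_mulVec, Matrix.smul_mulVec, dotProduct_sub, dotProduct_smul,
      dotProduct_infoMatrix_mulVec, dotProduct_infoMatrix_mulVec, smul_eq_mul]
    linarith [hup (WithLp.toLp 2 y)]
  · refine (hest x).trans ?_
    have h1 := hscore_inner x (hdir none)
    have h2 := mul_nonneg (dualNorm_nonneg P x) hq
    have h3 : 0 ≤ dualNorm P x * (√lam * W) := mul_nonneg (dualNorm_nonneg P x) (by positivity)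
    linarith

/-- The failure probabilities of the bound on the norm and of the directional bounds add up to at
most `δ`. -/
lemma failure_probability_le {T : ℕ} (hN : 1 ≤ N) (hT : 1 ≤ T) (htT : t ≤ T) (hδ : 0 < δ)
    (hNδ : 2 * δ ≤ N) :
    2 * Real.exp (-(3 * Real.log (N / δ))) +
      Fintype.card (Option (Fin t × Fin N)) * (2 * Real.exp (-(4 * Real.log (N * T / δ)))) ≤ δ := by
  have hN' : (1 : ℝ) ≤ N := by exact_mod_cast hN
  have hT' : (1 : ℝ) ≤ T := by exact_mod_cast hT
  have htT' : (t : ℝ) ≤ T := by exact_mod_cast htT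
  have hexp : ∀ (k : ℕ) (z : ℝ), 0 < z → Real.exp (-(k * Real.log (z / δ))) = (δ / z) ^ k := by
    intro k z hz
    rw [← mul_neg, ← Real.log_inv, inv_div, Real.exp_nat_mul, Real.exp_log (by positivity)]
  have hcube : ∀ z : ℝ, 2 * δ ≤ z → 0 < z → (δ / z) ^ 2 ≤ 1 / 4 ∧ (δ / z) ^ 3 ≤ 1 / 8 := by
    intro z hz hz0
    have h0 : 0 ≤ δ / z := by positivity
    have h1 : δ / z ≤ 1 / 2 := by rw [div_le_iff₀ hz0]; linarith
    constructor
    · calc (δ / z) ^ 2 ≤ (1 / 2) ^ 2 := by gcongr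
        _ = 1 / 4 := by norm_num
    · calc (δ / z) ^ 3 ≤ (1 / 2) ^ 3 := by gcongr
        _ = 1 / 8 := by norm_num
  have hNT : (N : ℝ) ≤ N * T := le_mul_of_one_le_right (by linarith) hT'
  have hNT0 : (0 : ℝ) < N * T := by linarith
  have e3 := hexp 3 N (by linarith)
  have e4 := hexp 4 (N * T) hNT0
  norm_num only [Nat.cast_ofNat] at e3 e4
  rw [e3, e4]
  have hcard : (Fintype.card (Option (Fin t × Fin N)) : ℝ) ≤ 2 * (N * T) := by
    have h : (Fintype.card (Option (Fin t × Fin N)) : ℝ) = t * N + 1 := by simp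
    rw [h]
    have := mul_le_mul_of_nonneg_right htT' (by linarith : (0 : ℝ) ≤ N)
    linarith
  have h1 : 2 * (δ / N) ^ 3 ≤ δ / 2 := by
    have ha : δ / N ≤ δ := div_le_self hδ.le hN'
    have hb := (hcube N hNδ (by linarith)).1
    have hc : 0 ≤ δ / N := by positivity
    nlinarith
  have h2 : (Fintype.card (Option (Fin t × Fin N)) : ℝ) * (2 * (δ / (N * T)) ^ 4) ≤ δ / 2 := by
    calc _ ≤ 2 * (N * T : ℝ) * (2 * (δ / (N * T)) ^ 4) := by gcongr
      _ = 4 * δ * (δ / (N * T)) ^ 3 := by field_simp; ring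
      _ ≤ 4 * δ * (1 / 8) := by
          gcongr
          exact (hcube (N * T) (hNδ.trans hNT) hNT0).2
      _ = δ / 2 := by ring
  linarith

end Confidence

end MNL

theorem mainTheorem1 {Ω : Type*} [MeasurableSpace Ω] (μ : Measure Ω) [IsProbabilityMeasure μ]
    (N d t T : ℕ) (hN : 1 ≤ N) (hT : 1 ≤ T) (htT : t ≤ T)
    (lam W δ P : ℝ) (hlam : 0 ≤ lam) (hW : 0 < W) (hδ0 : 0 < δ) (hδ1 : δ < 1)
    (hNδ : 2 * δ ≤ N)
    (θstar : Param d) (hθ : ‖θstar‖ ≤ W)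
    (D : Ω → PricingData N d t) (hmeas : MeasurableData D)
    (hfeat : ∀ ω m j, ‖(D ω).feature m j‖ ≤ 1)
    (hindep : CondIndepChoices μ D) (hmnl : MNLChoices μ D θstar)
    (x : EuclideanSpace ℝ (Fin d)) (hx : ‖x‖ ≤ 1) (p : ℝ) (hp : p ∈ Set.Icc 0 P) :
    ∃ good : Set Ω, MeasurableSet good ∧
      (∀ᵐ ω ∂μ, BurnIn (D ω) lam W δ θstar → 1 - δ ≤ (μ⟦good | designSigma D⟧) ω) ∧
      ∀ ω ∈ good, BurnIn (D ω) lam W δ θstar →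
        ∃ θhat : Param d, (D ω).IsMLE lam θhat ∧ (∀ η, (D ω).IsMLE lam η → η = θhat) ∧
          ((D ω).hessian lam θhat - (1 / 3 : ℝ) • (D ω).hessian lam θstar).PosSemidef ∧
          ((3 : ℝ) • (D ω).hessian lam θstar - (D ω).hessian lam θhat).PosSemidef ∧
          |inner ℝ (augment x p) (θhat - θstar)| ≤
            16 * weightedNorm ((D ω).hessian lam θstar)⁻¹ (augment x p) *
              (Real.sqrt (Real.log (N * T / δ)) + Real.sqrt lam * W) := by
  rcases Nat.eq_zero_or_pos d with rfl | hd
  · -- the parameter space is a point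
    refine ⟨Set.univ, MeasurableSet.univ, Filter.Eventually.of_forall fun ω _ => ?_,
      fun ω _ _ => ⟨θstar, fun η => (congrArg _ (Subsingleton.elim _ _)).le,
        fun η _ => Subsingleton.elim _ _, ?_, ?_, ?_⟩⟩
    · rw [Set.indicator_univ, condExp_const (MNL.designSigma_le hmeas)]
      linarith
    · rw [Subsingleton.elim ((D ω).hessian lam θstar - _) 0]
      exact Matrix.PosSemidef.zero
    · rw [Subsingleton.elim ((3 : ℝ) • (D ω).hessian lam θstar - _) 0]
      exact Matrix.PosSemidef.zero
    · rw [sub_self, inner_zero_right, abs_zero]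
      have : 0 ≤ weightedNorm ((D ω).hessian lam θstar)⁻¹ (augment x p) := Real.sqrt_nonneg _
      positivity
  have hN' : (1 : ℝ) ≤ N := by exact_mod_cast hN
  have hT' : (1 : ℝ) ≤ T := by exact_mod_cast hT
  have hL : 0 < Real.log (N / δ) := Real.log_pos (by rw [lt_div_iff₀ hδ0]; linarith)
  have hL' : 0 ≤ Real.log (N * T / δ) := by
    refine Real.log_nonneg ?_
    rw [le_div_iff₀ hδ0]
    nlinarith
  obtain ⟨hgood, hcond⟩ := MNL.condProb_choice_mem hmeas hindep hmnl
    (MNL.measurableSet_mem_goodChoices_designSigma D lam θstar (augment x p)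
      (4 * √(2 * d * Real.log (N / δ))) (5 * √(Real.log (N * T / δ))))
  refine ⟨_, hgood, ?_, fun ω hω hburn => MNL.exists_estimator_of_mem_goodChoices hd hlam hW hθ hL
    hburn _ (Real.sqrt_nonneg _) hω⟩
  filter_upwards [hcond, MNL.ae_choice_mem_optionSet hmeas hindep hmnl] with ω hω hvalid hburn
  rw [hω]
  obtain ⟨hdet, hf⟩ := hburn
  simp only [MNL.hessian_eq_infoMatrix hvalid, MNL.weightedNorm_eq_dualNorm] at hdet hf
  have hO := MNL.optionSet_nonempty (D ω)
  have hrank : (Module.finrank ℝ (Param d) : ℝ) = 2 * d := by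
    simp [finrank_euclideanSpace, two_mul]
  have h := MNL.le_prodProb_noise_bounds hO hlam
    (MNL.inner_info_pos_of_isUnit_det hO hlam hdet) (MNL.info_toEuclideanCLM_inv hdet)
    (L := Real.log (N / δ)) (L' := Real.log (N * T / δ)) (δ := δ)
    (by rw [finrank_euclideanSpace]; simpa using hd) hL hL'
    (fun m o ho => by
      rw [hrank]
      cases o with
      | none => simp [MNL.optionFeature, MNL.dualNorm]
      | some j => exact (hf m j (by simpa [MNL.optionSet] using ho)).1)
    (MNL.directions (D ω) (augment x p)) (MNL.failure_probability_le hN hT htT hδ0 hNδ)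
  rw [hrank] at h
  exact h
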